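/- There are a randomized algorithm, an absolute constant $K$ and numbers $\Omega=\Omega(n,d,\eta)$ with \[ \Omega \;\le\; K\cdot\frac{n+d}{\eta^{2}}\,\log(n+d)\qquad\text{for all integers } n,d\ge 1 \text{ and } 0<\eta\le\tfrac15 \] such that the following holds. Let $n,d\ge 1$, $0<\eta\le\frac15$ and $\Gamma>0$. Let $\|x\|=\sum_{i=1}^d\beta_i\,(|x|^{\downarrow})_i$ be a normalized ordered norm on $\mathbb{R}^d$, that is, $\beta_1\ge\dots\ge\beta_d\ge 0$ and $\sum_i\beta_i=1$, where $|x|^{\downarrow}$ denotes the vector of the $|x_j|$ sorted in non-increasing order. Let $\Psi:\mathbb{R}^d_{\ge0}\to\mathbb{R}_{\ge0}$ be a $\left(\frac{\ln d}{\eta},\eta\right)$-approximation of $\|\cdot\|$, that is, a differentiable convex function (with derivatives relative to the orthant at its boundary) such that for all $x,y\in\mathbb{R}^d_{\ge0}$ \[ \|x\|\le\Psi(x)\le\|x\|+\tfrac{\ln d}{\eta}\qquad\text{and}\qquad \nabla\Psi(x+y)\le e^{\eta\|y\|_\infty}\,\nabla\Psi(x)\ \text{ componentwise.} \] Let $X_1,\dots,X_n\subseteq\mathbb{R}^d_{\ge0}$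 be non-empty closed convex sets, let $X=\sum_{c=1}^n X_c$ and $\mathrm{OPT}=\min_{x\in X}\|x\|$. For each $c$ let an oracle be given that, for a price vector $y\in\mathbb{R}^d_{\ge0}$, returns a minimizer of $x\mapsto\langle y,x\rangle$ over $X_c$ (whenever one exists). Given $n,d,\eta,\Gamma$, and access to $\Psi$ only through evaluations of $\nabla\Psi$ and to the sets $X_c$ only through calls to their oracles, the algorithm always halts, and it either correctly decides that $\mathrm{OPT}>\Gamma$ or returns a vector $\bar s\in X$ with $\|\bar s\|\le(1+3\eta)\Gamma$. In every run it makes at most $4\Omega$ evaluations of $\nabla\Psi$ and at most $(4+n)\Omega$ oracle calls, and with probability at least $1-2(nd)^{-20}$ it makes at most $4\Omega$ oracle calls. (Here algorithms are considered in the oracle model: they work with exact real numbers, may sample from finite probability distributions, and only gradient evaluations and oracle calls are counted.) -/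

import Mathlib

/-! ### Ordered norms -/

/-- The non-negative orthant of `ℝ^d`. -/
def nonnegOrthant (d : ℕ) : Set (Fin d → ℝ) := {x | ∀ i, 0 ≤ x i}

/-- `|x|` sorted in non-increasing order: entry `i` is the `(i+1)`-st largest of the `|x j|`.
(`Tuple.sort u` is a permutation `π` for which `u ∘ π` is non-decreasing.) -/
noncomputable def sortedAbs {d : ℕ} (x : Fin d → ℝ) (i : Fin d) : ℝ :=
  |x (Tuple.sort (fun j => -|x j|) i)|

/-- The ordered norm with weight vector `β`. -/
noncomputable def orderedNorm {d : ℕ} (β x : Fin d → ℝ) : ℝ := ∑ i, β i * sortedAbs x i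

/-- Weight vectors of normalized ordered norms: non-increasing, non-negative, of `ℓ₁`-norm `1`. -/
structure IsOrderedWeight {d : ℕ} (β : Fin d → ℝ) : Prop where
  antitone : Antitone β
  nonneg : ∀ i, 0 ≤ β i
  sum_eq_one : ∑ i, β i = 1

/-! ### Smooth approximations of ordered norms -/

/-- The gradient of a function on the non-negative orthant. On the boundary of the orthant the
derivative is taken relative to the orthant (where it is unique, as the orthant is convex with
non-empty interior). -/
noncomputable def orthantGradient {d : ℕ} (Ψ : (Fin d → ℝ) → ℝ) (x : Fin d → ℝ) : Fin d → ℝ :=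
  fun i => fderivWithin ℝ Ψ (nonnegOrthant d) x (Pi.single i 1)

/-- `Ψ` (of which only the restriction to the non-negative orthant matters) is a
`(δ, η)`-approximation of the ordered norm with weights `β`. Here `‖y‖` is the maximum norm. -/
structure IsNormApproximation {d : ℕ} (δ η : ℝ) (β : Fin d → ℝ) (Ψ : (Fin d → ℝ) → ℝ) :
    Prop where
  differentiableOn : DifferentiableOn ℝ Ψ (nonnegOrthant d)
  convexOn : ConvexOn ℝ (nonnegOrthant d) Ψ
  nonneg : ∀ x ∈ nonnegOrthant d, 0 ≤ Ψ x
  norm_le : ∀ x ∈ nonnegOrthant d, orderedNorm β x ≤ Ψ x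
  le_norm_add : ∀ x ∈ nonnegOrthant d, Ψ x ≤ orderedNorm β x + δ
  gradient_le : ∀ x ∈ nonnegOrthant d, ∀ y ∈ nonnegOrthant d, ∀ i,
    orthantGradient Ψ (x + y) i ≤ Real.exp (η * ‖y‖) * orthantGradient Ψ x i

/-! ### Instances of fractional load balancing -/

/-- The sets `X c` (`c` a customer) form an instance: they are non-empty closed convex subsets of
the non-negative orthant. -/
structure IsLoadInstance {n d : ℕ} (X : Fin n → Set (Fin d → ℝ)) : Prop where
  nonempty : ∀ c, (X c).Nonempty
  closed : ∀ c, IsClosed (X c)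
  convex : ∀ c, Convex ℝ (X c)
  subset : ∀ c, X c ⊆ nonnegOrthant d

/-- The set `∑ c, X c` of feasible solutions. -/
def feasibleSet {n d : ℕ} (X : Fin n → Set (Fin d → ℝ)) : Set (Fin d → ℝ) :=
  {s | ∃ x : Fin n → Fin d → ℝ, (∀ c, x c ∈ X c) ∧ s = ∑ c, x c}

/-- The optimum value: the least ordered norm of a feasible solution. -/
noncomputable def optValue {n d : ℕ} (β : Fin d → ℝ) (X : Fin n → Set (Fin d → ℝ)) : ℝ :=
  sInf (orderedNorm β '' feasibleSet X)

/-- `f` is a family of linear minimization oracles for the sets `X c`: given prices `y ≥ 0`,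
`f c y` minimizes `x ↦ ⟨y, x⟩` over `X c`, whenever a minimizer exists (which is always the case
if all prices are positive). -/
def IsLinMinOracle {n d : ℕ} (X : Fin n → Set (Fin d → ℝ))
    (f : Fin n → (Fin d → ℝ) → (Fin d → ℝ)) : Prop :=
  ∀ c, ∀ y ∈ nonnegOrthant d,
    (∃ x ∈ X c, ∀ x' ∈ X c, dotProduct y x ≤ dotProduct y x') →
      f c y ∈ X c ∧ ∀ x' ∈ X c, dotProduct y (f c y) ≤ dotProduct y x'

/-! ### Randomized algorithms with oracle access -/

/-- Randomized oracle algorithms for `n` customers and `d` resources. An algorithm either halts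
with an output (`none` stands for the decision that the optimum exceeds the given guess, `some s`
for the solution `s`), or asks for the gradient at a point `x`, or calls the oracle of customer
`c` with prices `y`, or draws a random number from a distribution on `{0, …, m-1}`, and continues
depending on the answer. The answers to its calls are all that it learns about the instance and
about the norm approximation. As the type is inductive, every run halts. -/
inductive OracleAlg (n d : ℕ) : Type
  | halt (out : Option (Fin d → ℝ)) : OracleAlg n d
  | gradient (x : Fin d → ℝ) (next : (Fin d → ℝ) → OracleAlg n d) : OracleAlg n d
  | oracle (c : Fin n) (y : Fin d → ℝ) (next : (Fin d → ℝ) → OracleAlg n d) : OracleAlg n d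
  | sample {m : ℕ} (p : PMF (Fin m)) (next : Fin m → OracleAlg n d) : OracleAlg n d

/-- The result of a run: the output and the numbers of calls made. -/
structure RunResult (d : ℕ) : Type where
  out : Option (Fin d → ℝ)
  gradientEvals : ℕ
  oracleCalls : ℕ

/-- The distribution of the result of a run, where gradient evaluations are answered by `g` and
oracle calls by `f`. -/
noncomputable def OracleAlg.run {n d : ℕ} (g : (Fin d → ℝ) → (Fin d → ℝ))
    (f : Fin n → (Fin d → ℝ) → (Fin d → ℝ)) : OracleAlg n d → PMF (RunResult d)
  | .halt out => PMF.pure ⟨out, 0, 0⟩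
  | .gradient x next => ((next (g x)).run g f).map
      fun r => { r with gradientEvals := r.gradientEvals + 1 }
  | .oracle c y next => ((next (f c y)).run g f).map
      fun r => { r with oracleCalls := r.oracleCalls + 1 }
  | .sample p next => p.bind fun j => (next j).run g f

/-! ### Runs of oracle algorithms -/

/-- The probability that a run makes more than `b` oracle calls. -/
noncomputable def OracleAlg.overrun {n d : ℕ} (g : (Fin d → ℝ) → (Fin d → ℝ))
    (f : Fin n → (Fin d → ℝ) → (Fin d → ℝ)) (A : OracleAlg n d) (b : ℕ) : ENNReal :=
  (A.run g f).toOuterMeasure {r | b < r.oracleCalls}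

/-- Every run ends with an output that satisfies `good`, after at most `G` gradient evaluations and
at most `C` oracle calls. -/
def OracleAlg.Guarantee {n d : ℕ} (g : (Fin d → ℝ) → (Fin d → ℝ))
    (f : Fin n → (Fin d → ℝ) → (Fin d → ℝ)) (good : Option (Fin d → ℝ) → Prop)
    (A : OracleAlg n d) (G C : ℕ) : Prop :=
  ∀ r ∈ (A.run g f).support, good r.out ∧ r.gradientEvals ≤ G ∧ r.oracleCalls ≤ C

/-- The distribution on `Fin n` proportional to the weights `max 1 (u c)`. -/
noncomputable def weightedPMF {n : ℕ} [NeZero n] (u : Fin n → ℝ) : PMF (Fin n) :=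
  PMF.normalize (fun c => ENNReal.ofReal (max 1 (u c)))
    (by
      rw [tsum_fintype]
      intro h
      have h0 := (Finset.sum_eq_zero_iff.mp h) 0 (Finset.mem_univ _)
      rw [ENNReal.ofReal_eq_zero] at h0
      linarith [le_max_left 1 (u 0)])
    (by
      rw [tsum_fintype]
      exact ENNReal.sum_ne_top.mpr fun c _ => ENNReal.ofReal_ne_top)

lemma weightedPMF_apply {n : ℕ} [NeZero n] (u : Fin n → ℝ) (hu : ∀ c, 1 ≤ u c) (c : Fin n) :
    weightedPMF u c = ENNReal.ofReal (u c / ∑ c, u c) := by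
  have hpos : 0 < ∑ c, u c :=
    Finset.sum_pos (fun c _ => by linarith [hu c]) Finset.univ_nonempty
  have hmax : (fun c => ENNReal.ofReal (max 1 (u c))) = fun c => ENNReal.ofReal (u c) := by
    funext c
    rw [max_eq_right (hu c)]
  rw [weightedPMF, PMF.normalize_apply, hmax, max_eq_right (hu c), tsum_fintype,
    ← ENNReal.ofReal_sum_of_nonneg (fun c _ => by linarith [hu c]),
    ENNReal.ofReal_div_of_pos hpos, div_eq_mul_inv]

namespace OracleAlg

variable {n d : ℕ} {g : (Fin d → ℝ) → (Fin d → ℝ)} {f : Fin n → (Fin d → ℝ) → (Fin d → ℝ)}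

lemma overrun_le_one (A : OracleAlg n d) (b : ℕ) : A.overrun g f b ≤ 1 := by
  rw [← (PMF.toOuterMeasure_apply_eq_one_iff (A.run g f) (s := Set.univ)).mpr (Set.subset_univ _)]
  exact MeasureTheory.measure_mono (Set.subset_univ _)

lemma overrun_halt (o : Option (Fin d → ℝ)) (b : ℕ) : (halt o : OracleAlg n d).overrun g f b = 0 := by
  simp [overrun, run]

lemma overrun_gradient (x : Fin d → ℝ) (k : (Fin d → ℝ) → OracleAlg n d) (b : ℕ) :
    (gradient x k).overrun g f b = (k (g x)).overrun g f b := by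
  simp only [overrun, run, PMF.toOuterMeasure_map_apply]
  rfl

lemma overrun_oracle (c : Fin n) (y : Fin d → ℝ) (k : (Fin d → ℝ) → OracleAlg n d) (b : ℕ) :
    (oracle c y k).overrun g f (b + 1) = (k (f c y)).overrun g f b := by
  simp only [overrun, run, PMF.toOuterMeasure_map_apply]
  congr 1
  ext r
  simp

lemma overrun_sample_weighted_le {N : ℕ} [NeZero N] {u : Fin N → ℝ}
    (hu : ∀ c, 1 ≤ u c) (k : Fin N → OracleAlg n d) (b : ℕ) {e : Fin N → ℝ} {E : ℝ}
    (he : ∀ c, 0 ≤ e c) (hk : ∀ c, (k c).overrun g f b ≤ ENNReal.ofReal (e c))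
    (hE : ∑ c, u c * e c ≤ E * ∑ c, u c) :
    (sample (weightedPMF u) k).overrun g f b ≤ ENNReal.ofReal E := by
  have hpos : 0 < ∑ c, u c :=
    Finset.sum_pos (fun c _ => by linarith [hu c]) Finset.univ_nonempty
  have hu0 : ∀ c, 0 ≤ u c / ∑ c, u c := fun c => div_nonneg (by linarith [hu c]) hpos.le
  rw [overrun, run, PMF.toOuterMeasure_bind_apply, tsum_fintype]
  calc ∑ c, weightedPMF u c * ((k c).run g f).toOuterMeasure {r | b < r.oracleCalls}
      ≤ ∑ c, ENNReal.ofReal (u c / (∑ c, u c) * e c) := by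
        refine Finset.sum_le_sum fun c _ => ?_
        rw [weightedPMF_apply u hu, ENNReal.ofReal_mul (hu0 c)]
        gcongr
        exact hk c
    _ = ENNReal.ofReal (∑ c, u c / (∑ c, u c) * e c) :=
        (ENNReal.ofReal_sum_of_nonneg fun c _ => mul_nonneg (hu0 c) (he c)).symm
    _ ≤ ENNReal.ofReal E := by
        refine ENNReal.ofReal_le_ofReal ?_
        rw [← mul_le_mul_iff_left₀ hpos, Finset.sum_mul]
        refine le_trans (le_of_eq (Finset.sum_congr rfl fun c _ => ?_)) hE
        field_simp

variable {good : Option (Fin d → ℝ) → Prop}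

lemma Guarantee.mono {A : OracleAlg n d} {G C G' C' : ℕ} (h : A.Guarantee g f good G C)
    (hG : G ≤ G') (hC : C ≤ C') : A.Guarantee g f good G' C' := fun r hr =>
  ⟨(h r hr).1, (h r hr).2.1.trans hG, (h r hr).2.2.trans hC⟩

lemma guarantee_halt {o : Option (Fin d → ℝ)} (ho : good o) (G C : ℕ) :
    (halt o : OracleAlg n d).Guarantee g f good G C := by
  intro r hr
  simp only [run, PMF.support_pure, Set.mem_singleton_iff] at hr
  subst hr
  exact ⟨ho, Nat.zero_le _, Nat.zero_le _⟩

lemma guarantee_gradient {x : Fin d → ℝ} {k : (Fin d → ℝ) → OracleAlg n d} {G C : ℕ}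
    (h : (k (g x)).Guarantee g f good G C) : (gradient x k).Guarantee g f good (G + 1) C := by
  intro r hr
  simp only [run, PMF.support_map, Set.mem_image] at hr
  obtain ⟨r, hr, rfl⟩ := hr
  exact ⟨(h r hr).1, Nat.succ_le_succ (h r hr).2.1, (h r hr).2.2⟩

lemma guarantee_oracle {c : Fin n} {y : Fin d → ℝ} {k : (Fin d → ℝ) → OracleAlg n d} {G C : ℕ}
    (h : (k (f c y)).Guarantee g f good G C) : (oracle c y k).Guarantee g f good G (C + 1) := by
  intro r hr
  simp only [run, PMF.support_map, Set.mem_image] at hr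
  obtain ⟨r, hr, rfl⟩ := hr
  exact ⟨(h r hr).1, (h r hr).2.1, Nat.succ_le_succ (h r hr).2.2⟩

lemma guarantee_sample {N : ℕ} {p : PMF (Fin N)} {k : Fin N → OracleAlg n d} {G C : ℕ}
    (h : ∀ c, (k c).Guarantee g f good G C) : (sample p k).Guarantee g f good G C := by
  intro r hr
  simp only [run, PMF.mem_support_bind_iff] at hr
  obtain ⟨c, -, hr⟩ := hr
  exact h c r hr

/-- Call the oracles of the customers in a list with the same prices. -/
def askList (y : Fin d → ℝ) (k : (Fin n → Fin d → ℝ) → OracleAlg n d) :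
    List (Fin n) → (Fin n → Fin d → ℝ) → OracleAlg n d
  | [], ans => k ans
  | c :: cs, ans => .oracle c y fun v => askList y k cs (Function.update ans c v)

/-- Call the oracles of all customers with the same prices. -/
def askAll (y : Fin d → ℝ) (k : (Fin n → Fin d → ℝ) → OracleAlg n d) : OracleAlg n d :=
  askList y k (List.finRange n) 0

/-- The answers known after `askList`. -/
def answers (f : Fin n → (Fin d → ℝ) → (Fin d → ℝ)) (y : Fin d → ℝ) :
    List (Fin n) → (Fin n → Fin d → ℝ) → (Fin n → Fin d → ℝ)
  | [], ans => ans
  | c :: cs, ans => answers f y cs (Function.update ans c (f c y))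

lemma answers_apply (y : Fin d → ℝ) (l : List (Fin n)) (ans : Fin n → Fin d → ℝ) (c : Fin n) :
    (c ∈ l ∨ ans c = f c y) → answers f y l ans c = f c y := by
  induction l generalizing ans with
  | nil => simp [answers]
  | cons a l ih =>
    intro h
    refine ih _ ?_
    by_cases hc : c = a
    · subst hc
      simp
    · rcases h with h | h
      · exact Or.inl ((List.mem_cons.mp h).resolve_left hc)
      · right
        rw [Function.update_of_ne hc, h]

lemma answers_finRange (y : Fin d → ℝ) :
    answers f y (List.finRange n) 0 = fun c => f c y :=
  funext fun c => answers_apply y _ _ c (Or.inl (List.mem_finRange c))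

lemma overrun_askAll (y : Fin d → ℝ) (k : (Fin n → Fin d → ℝ) → OracleAlg n d) (b : ℕ) :
    (askAll y k).overrun g f (b + n) = (k fun c => f c y).overrun g f b := by
  have key : ∀ (l : List (Fin n)) (ans : Fin n → Fin d → ℝ),
      (askList y k l ans).overrun g f (b + l.length) = (k (answers f y l ans)).overrun g f b := by
    intro l
    induction l with
    | nil => exact fun ans => rfl
    | cons a l ih =>
      intro ans
      rw [askList, List.length_cons, ← add_assoc, overrun_oracle, ih]
      rfl
  have := key (List.finRange n) 0
  rwa [List.length_finRange, answers_finRange] at this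

lemma guarantee_askAll {y : Fin d → ℝ} {k : (Fin n → Fin d → ℝ) → OracleAlg n d} {G C : ℕ}
    (h : (k fun c => f c y).Guarantee g f good G C) :
    (askAll y k).Guarantee g f good G (C + n) := by
  have key : ∀ (l : List (Fin n)) (ans : Fin n → Fin d → ℝ),
      (k (answers f y l ans)).Guarantee g f good G C →
      (askList y k l ans).Guarantee g f good G (C + l.length) := by
    intro l
    induction l with
    | nil => exact fun ans h => h
    | cons a l ih =>
      intro ans h
      rw [List.length_cons, ← add_assoc]
      exact guarantee_oracle (ih _ h)
  have := key (List.finRange n) 0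
  rw [List.length_finRange, answers_finRange] at this
  exact this h

end OracleAlg

/-! ### Randomized local search -/

/-- The ingredients of a local search with states `S`. At a state the gradient is evaluated at
`point`; then `settle` may replace the state or end the search. Otherwise one looks for a customer
whose answer to `price` improves the state, sampling customers proportionally to `weight`.
The answers of all customers together may also refute that a solution exists. -/
structure SearchScheme (n d : ℕ) (S : Type) where
  point : S → (Fin d → ℝ)
  settle : S → (Fin d → ℝ) → Option (S ⊕ (Fin d → ℝ))
  price : S → (Fin d → ℝ) → (Fin d → ℝ)
  weight : S → (Fin d → ℝ) → Fin n → ℝ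
  improve : S → (Fin d → ℝ) → Fin n → (Fin d → ℝ) → Option S
  refutes : S → (Fin d → ℝ) → (Fin n → Fin d → ℝ) → Prop

namespace SearchScheme

variable {n d : ℕ} {S : Type}

open Classical in
/-- Ask all customers; continue with an improved state if there is one. -/
noncomputable def scan (σ : SearchScheme n d S) (s : S) (p : Fin d → ℝ) (k : S → OracleAlg n d) :
    OracleAlg n d :=
  OracleAlg.askAll (σ.price s p) fun ans =>
    if σ.refutes s p ans then .halt none
    else if h : ∃ s' c, σ.improve s p c (ans c) = some s' then k h.choose
    else .halt none

/-- Look for an improved state: in each iteration scan all customers with probability `1 / n`, and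
ask a random customer otherwise; scan when the budget of oracle calls is used up. -/
noncomputable def loop [NeZero n] (σ : SearchScheme n d S) (s : S) (p : Fin d → ℝ)
    (k : ℕ → S → OracleAlg n d) : ℕ → OracleAlg n d
  | 0 => σ.scan s p (k 0)
  | b + 1 => .sample (weightedPMF fun _ : Fin n => 1) fun j =>
      if j = 0 then σ.scan s p (k (b + 1 - n))
      else .sample (weightedPMF (σ.weight s p)) fun c => .oracle c (σ.price s p) fun v =>
        match σ.improve s p c v with
        | some s' => k b s'
        | none => loop σ s p k b

/-- The search with at most `k` gradient evaluations and about `b` oracle calls before it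
becomes deterministic. -/
noncomputable def search [NeZero n] (σ : SearchScheme n d S) : ℕ → ℕ → S → OracleAlg n d
  | 0, _, _ => .halt none
  | k + 1, b, s => .gradient (σ.point s) fun p =>
      match σ.settle s p with
      | some (.inl s') => search σ k b s'
      | some (.inr x) => .halt (some x)
      | none => σ.loop s p (search σ k) b

/-- The change of the potential when customer `c` is asked. -/
noncomputable def factor (σ : SearchScheme n d S) (f : Fin n → (Fin d → ℝ) → (Fin d → ℝ))
    (W : S → ℝ) (s : S) (p : Fin d → ℝ) (c : Fin n) : ℝ :=
  match σ.improve s p c (f c (σ.price s p)) with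
  | some s' => Real.exp (W s' - W s)
  | none => 1

lemma factor_pos (σ : SearchScheme n d S) (f : Fin n → (Fin d → ℝ) → (Fin d → ℝ))
    (W : S → ℝ) (s : S) (p : Fin d → ℝ) (c : Fin n) : 0 < σ.factor f W s p c := by
  unfold factor
  split
  · exact Real.exp_pos _
  · exact one_pos

/-- `W` is a potential for the search scheme: it drops by at least `h` with every new state, and
asking a random customer decreases it in expectation. -/
structure IsPotential (σ : SearchScheme n d S) (g : (Fin d → ℝ) → (Fin d → ℝ))
    (f : Fin n → (Fin d → ℝ) → (Fin d → ℝ)) (good : Option (Fin d → ℝ) → Prop)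
    (Inv : S → Prop) (W : S → ℝ) (h : ℝ) : Prop where
  nonneg : ∀ s, Inv s → 0 ≤ W s
  settle_state : ∀ s s', Inv s → σ.settle s (g (σ.point s)) = some (.inl s') →
    Inv s' ∧ W s' + h ≤ W s
  settle_out : ∀ s x, Inv s → σ.settle s (g (σ.point s)) = some (.inr x) → good (some x)
  improve : ∀ s s' c, Inv s → σ.settle s (g (σ.point s)) = none →
    σ.improve s (g (σ.point s)) c (f c (σ.price s (g (σ.point s)))) = some s' →
    Inv s' ∧ W s' + h ≤ W s
  refutes : ∀ s, Inv s → σ.settle s (g (σ.point s)) = none →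
    σ.refutes s (g (σ.point s)) (fun c => f c (σ.price s (g (σ.point s)))) → good none
  one_le_weight : ∀ s, Inv s → σ.settle s (g (σ.point s)) = none →
    ∀ c, 1 ≤ σ.weight s (g (σ.point s)) c
  decrease : ∀ s, Inv s → σ.settle s (g (σ.point s)) = none →
    ¬ σ.refutes s (g (σ.point s)) (fun c => f c (σ.price s (g (σ.point s)))) →
    ∑ c, σ.weight s (g (σ.point s)) c * σ.factor f W s (g (σ.point s)) c ≤
      (1 - h / 2) * ∑ c, σ.weight s (g (σ.point s)) c

variable {σ : SearchScheme n d S} {g : (Fin d → ℝ) → (Fin d → ℝ)}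
  {f : Fin n → (Fin d → ℝ) → (Fin d → ℝ)} {good : Option (Fin d → ℝ) → Prop}
  {Inv : S → Prop} {W : S → ℝ} {h : ℝ}

lemma IsPotential.overrun_scan_le (H : σ.IsPotential g f good Inv W h) {s : S}
    (hs : Inv s) (hset : σ.settle s (g (σ.point s)) = none) {k : S → OracleAlg n d} {b : ℕ} {e : ℝ}
    (hk : ∀ s', Inv s' → W s' + h ≤ W s → (k s').overrun g f b ≤ ENNReal.ofReal e) :
    (σ.scan s (g (σ.point s)) k).overrun g f (b + n) ≤ ENNReal.ofReal e := by
  rw [scan, OracleAlg.overrun_askAll]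
  split_ifs with href hex
  · rw [OracleAlg.overrun_halt]
    exact zero_le
  · obtain ⟨c, hc⟩ := hex.choose_spec
    obtain ⟨h1, h2⟩ := H.improve s _ c hs hset hc
    exact hk _ h1 h2
  · rw [OracleAlg.overrun_halt]
    exact zero_le

lemma overrun_scan_of_refutes {s : S} {p : Fin d → ℝ}
    (href : σ.refutes s p (fun c => f c (σ.price s p))) (k : S → OracleAlg n d) (b : ℕ) :
    (σ.scan s p k).overrun g f (b + n) = 0 := by
  rw [scan, OracleAlg.overrun_askAll, if_pos href, OracleAlg.overrun_halt]

/-- The bound on the probability of an overrun for a state of potential `W` and budget `b`. -/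
noncomputable def tail (n : ℕ) (h W : ℝ) (b : ℕ) : ℝ := Real.exp (W + h / 8 * n - h / 8 * b)

lemma overrun_le_tail_of_le (A : OracleAlg n d) {W : ℝ} (hW : 0 ≤ W) (hh : 0 < h) {b : ℕ}
    (hb : b ≤ n) : A.overrun g f b ≤ ENNReal.ofReal (tail n h W b) := by
  refine (A.overrun_le_one b).trans ?_
  rw [ENNReal.one_le_ofReal, tail, Real.one_le_exp_iff]
  have : (b : ℝ) ≤ n := by exact_mod_cast hb
  nlinarith

variable [NeZero n]

lemma IsPotential.exists_improve (H : σ.IsPotential g f good Inv W h) (hh : 0 < h) {s : S}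
    (hs : Inv s) (hset : σ.settle s (g (σ.point s)) = none)
    (href : ¬ σ.refutes s (g (σ.point s)) (fun c => f c (σ.price s (g (σ.point s))))) :
    ∃ s' c, σ.improve s (g (σ.point s)) c (f c (σ.price s (g (σ.point s)))) = some s' := by
  by_contra hne
  push Not at hne
  have hw := H.one_le_weight s hs hset
  have hpos : 0 < ∑ c, σ.weight s (g (σ.point s)) c :=
    Finset.sum_pos (fun c _ => by linarith [hw c]) Finset.univ_nonempty
  have hf : ∀ c, σ.factor f W s (g (σ.point s)) c = 1 := by
    intro c
    unfold factor
    split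
    · next s' hs' => exact absurd hs' (hne s' c)
    · rfl
  have hd := H.decrease s hs hset href
  simp only [hf, mul_one] at hd
  nlinarith

lemma IsPotential.guarantee_scan (H : σ.IsPotential g f good Inv W h) (hh : 0 < h) {s : S}
    (hs : Inv s) (hset : σ.settle s (g (σ.point s)) = none) {k : S → OracleAlg n d} {G C : ℕ}
    (hk : ∀ s', Inv s' → W s' + h ≤ W s → (k s').Guarantee g f good G C) :
    (σ.scan s (g (σ.point s)) k).Guarantee g f good G (C + n) := by
  refine OracleAlg.guarantee_askAll ?_
  split_ifs with href hex
  · exact OracleAlg.guarantee_halt (H.refutes s hs hset href) _ _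
  · obtain ⟨c, hc⟩ := hex.choose_spec
    obtain ⟨h1, h2⟩ := H.improve s _ c hs hset hc
    exact hk _ h1 h2
  · exact absurd (H.exists_improve hh hs hset href) hex

lemma IsPotential.guarantee_loop (H : σ.IsPotential g f good Inv W h) (hh : 0 < h) {s : S}
    (hs : Inv s) (hset : σ.settle s (g (σ.point s)) = none) {k : ℕ → S → OracleAlg n d} {G C : ℕ}
    (hk : ∀ b s', Inv s' → W s' + h ≤ W s → (k b s').Guarantee g f good G (b + C)) (b : ℕ) :
    (σ.loop s (g (σ.point s)) k b).Guarantee g f good G (b + (C + n)) := by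
  induction b with
  | zero =>
    rw [← add_assoc]
    exact H.guarantee_scan hh hs hset (hk 0)
  | succ b ih =>
    refine OracleAlg.guarantee_sample fun j => ?_
    split_ifs with hj
    · exact (H.guarantee_scan hh hs hset (hk (b + 1 - n))).mono le_rfl (by omega)
    · refine OracleAlg.guarantee_sample fun c => ?_
      rw [show b + 1 + (C + n) = b + (C + n) + 1 by ring]
      refine OracleAlg.guarantee_oracle ?_
      split
      · next s' hs' =>
        obtain ⟨h1, h2⟩ := H.improve s _ c hs hset hs'
        exact (hk b s' h1 h2).mono le_rfl (by omega)
      · exact ih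

theorem IsPotential.guarantee_search (H : σ.IsPotential g f good Inv W h) (hh : 0 < h) (k b : ℕ)
    (s : S) (hs : Inv s) (hW : W s < h * k) :
    (σ.search k b s).Guarantee g f good k (b + n * k) := by
  induction k generalizing b s with
  | zero =>
    have := H.nonneg s hs
    simp only [Nat.cast_zero, mul_zero] at hW
    linarith
  | succ k ih =>
    push_cast at hW
    have next : ∀ b s', Inv s' → W s' + h ≤ W s →
        (σ.search k b s').Guarantee g f good k (b + n * k) :=
      fun b s' h1 h2 => ih b s' h1 (by linarith)
    refine OracleAlg.guarantee_gradient ?_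
    rcases hset : σ.settle s (g (σ.point s)) with _ | (s' | x)
    · rw [mul_add, mul_one]
      exact H.guarantee_loop hh hs hset next b
    · obtain ⟨h1, h2⟩ := H.settle_state s s' hs hset
      exact (next b s' h1 h2).mono le_rfl (by gcongr; omega)
    · exact OracleAlg.guarantee_halt (H.settle_out s x hs hset) _ _

lemma exp_le_one_add_two_mul {x : ℝ} (h0 : 0 ≤ x) (h1 : x ≤ 1) : Real.exp x ≤ 1 + 2 * x := by
  have := Real.abs_exp_sub_one_le (x := x) (by rwa [abs_of_nonneg h0])
  rw [abs_of_nonneg h0] at this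
  linarith [le_abs_self (Real.exp x - 1)]

lemma exp_neg_le_one_sub_half {x : ℝ} (h0 : 0 ≤ x) (h1 : x ≤ 1) : Real.exp (-x) ≤ 1 - x / 2 := by
  have h2 := Real.add_one_le_exp x
  have h3 : Real.exp (-x) ≤ 1 / (1 + x) := by
    rw [Real.exp_neg, ← one_div]
    exact one_div_le_one_div_of_le (by linarith) (by linarith)
  refine h3.trans ?_
  rw [div_le_iff₀ (by linarith)]
  nlinarith

lemma IsPotential.overrun_loop_le (H : σ.IsPotential g f good Inv W h) (hh : 0 < h) (h1 : h ≤ 1)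
    (hn : h * n ≤ 1) {s : S} (hs : Inv s) (hset : σ.settle s (g (σ.point s)) = none)
    {k : ℕ → S → OracleAlg n d}
    (hk : ∀ b s', Inv s' → W s' + h ≤ W s →
      (k b s').overrun g f b ≤ ENNReal.ofReal (tail n h (W s') b)) (b : ℕ) :
    (σ.loop s (g (σ.point s)) k b).overrun g f b ≤ ENNReal.ofReal (tail n h (W s) b) := by
  have hn1 : (1 : ℝ) ≤ n := by exact_mod_cast Nat.one_le_iff_ne_zero.mpr (NeZero.ne n)
  have hW := H.nonneg s hs
  induction b with
  | zero => exact overrun_le_tail_of_le _ hW hh (Nat.zero_le _)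
  | succ b ih =>
    rcases le_or_gt (b + 1) n with hb | hb
    · exact overrun_le_tail_of_le _ hW hh hb
    set p := g (σ.point s) with hp
    set t := tail n h (W s) (b + 1) with ht
    have ht0 : 0 < t := Real.exp_pos _
    have hw := H.one_le_weight s hs hset
    have hsum : 0 ≤ ∑ c, σ.weight s p c := Finset.sum_nonneg fun c _ => by linarith [hw c]
    have hstep : tail n h (W s) b = t * Real.exp (h / 8) := by
      rw [ht, tail, tail, ← Real.exp_add]
      push_cast
      ring_nf
    have hask : ∀ (E : ℝ), ∑ c, σ.weight s p c * σ.factor f W s p c ≤ E * ∑ c, σ.weight s p c →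
        (OracleAlg.sample (weightedPMF (σ.weight s p)) fun c =>
          OracleAlg.oracle c (σ.price s p) fun v =>
            match σ.improve s p c v with
            | some s' => k b s'
            | none => loop σ s p k b).overrun g f (b + 1) ≤
          ENNReal.ofReal (t * Real.exp (h / 8) * E) := by
      intro E hE
      refine OracleAlg.overrun_sample_weighted_le hw _ _
        (e := fun c => t * Real.exp (h / 8) * σ.factor f W s p c)
        (fun c => (mul_pos (mul_pos ht0 (Real.exp_pos _)) (factor_pos ..)).le) (fun c => ?_) ?_
      · rw [OracleAlg.overrun_oracle]
        unfold factor
        split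
        · next s' hs' =>
          obtain ⟨i1, i2⟩ := H.improve s s' c hs hset hs'
          refine (hk b s' i1 i2).trans (le_of_eq ?_)
          rw [← hstep, tail, tail]
          rw [← Real.exp_add]
          ring_nf
        · next hs' =>
          rw [mul_one, ← hstep]
          exact ih
      · calc ∑ c, σ.weight s p c * (t * Real.exp (h / 8) * σ.factor f W s p c)
            = t * Real.exp (h / 8) * ∑ c, σ.weight s p c * σ.factor f W s p c := by
              rw [Finset.mul_sum]
              exact Finset.sum_congr rfl fun c _ => by ring
          _ ≤ t * Real.exp (h / 8) * (E * ∑ c, σ.weight s p c) := by gcongr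
          _ = _ := by ring
    have hcoin : ∀ A B : ℝ, 0 ≤ A → 0 ≤ B → A + (n - 1) * B ≤ n * t →
        (σ.scan s p (k (b + 1 - n))).overrun g f (b + 1) ≤ ENNReal.ofReal A →
        (OracleAlg.sample (weightedPMF (σ.weight s p)) fun c =>
          OracleAlg.oracle c (σ.price s p) fun v =>
            match σ.improve s p c v with
            | some s' => k b s'
            | none => loop σ s p k b).overrun g f (b + 1) ≤ ENNReal.ofReal B →
        (σ.loop s p k (b + 1)).overrun g f (b + 1) ≤ ENNReal.ofReal t := by
      intro A B hA hB hAB hsc hsa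
      refine OracleAlg.overrun_sample_weighted_le (fun _ => le_rfl) _ _
        (e := fun j => if j = 0 then A else B) (fun j => ?_) (fun j => ?_) ?_
      · split_ifs <;> assumption
      · split_ifs <;> assumption
      · have : ∑ j : Fin n, (if j = 0 then A else B) = A + (n - 1) * B := by
          rw [← Finset.add_sum_erase _ _ (Finset.mem_univ (0 : Fin n)), if_pos rfl,
            Finset.sum_congr rfl (g := fun _ => B)
              (fun j hj => if_neg (Finset.ne_of_mem_erase hj)),
            Finset.sum_const, Finset.card_erase_of_mem (Finset.mem_univ _), Finset.card_univ,
            Fintype.card_fin, nsmul_eq_mul, Nat.cast_sub (by exact_mod_cast hn1), Nat.cast_one]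
        simp only [one_mul, this, Finset.sum_const, Finset.card_univ, Fintype.card_fin,
          nsmul_eq_mul, mul_one]
        linarith
    have hbn : b + 1 - n + n = b + 1 := by omega
    have hexp : Real.exp (h / 8) ≤ 1 + h / 4 := by
      have := exp_le_one_add_two_mul (x := h / 8) (by linarith) (by linarith)
      linarith
    by_cases href : σ.refutes s p (fun c => f c (σ.price s p))
    · refine hcoin 0 (t * Real.exp (h / 8) * 1) le_rfl (by positivity) ?_ ?_ (hask 1 ?_)
      · rw [zero_add, mul_one]
        have : (n - 1) * Real.exp (h / 8) ≤ n := by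
          calc ((n : ℝ) - 1) * Real.exp (h / 8) ≤ (n - 1) * (1 + h / 4) := by
                gcongr
            _ ≤ n := by nlinarith
        nlinarith
      · have := overrun_scan_of_refutes (g := g) href (k (b + 1 - n)) (b + 1 - n)
        rw [hbn] at this
        rw [this]
        exact zero_le
      · rw [one_mul]
        refine Finset.sum_le_sum fun c _ => ?_
        have : σ.factor f W s p c ≤ 1 := by
          unfold factor
          split
          · next s' hs' =>
            have := (H.improve s s' c hs hset hs').2
            exact Real.exp_le_one_iff.mpr (by linarith)
          · exact le_rfl
        nlinarith [hw c]
    · refine hcoin (t * Real.exp (h / 8 * n) * Real.exp (-h)) (t * Real.exp (h / 8) * (1 - h / 2))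
        (by positivity) (mul_nonneg (by positivity) (by linarith)) ?_ ?_
        (hask _ (H.decrease s hs hset href))
      · have e1 : Real.exp (h / 8 * n) ≤ 1 + h * n / 4 := by
          have := exp_le_one_add_two_mul (x := h / 8 * n) (by positivity) (by nlinarith)
          linarith
        have e2 : Real.exp (-h) ≤ 1 - h / 2 := exp_neg_le_one_sub_half hh.le h1
        have e3 : Real.exp (h / 8 * n) * Real.exp (-h) ≤ (1 + h * n / 4) * (1 - h / 2) :=
          mul_le_mul e1 e2 (Real.exp_pos _).le (by positivity)
        have e4 : ((n : ℝ) - 1) * (Real.exp (h / 8) * (1 - h / 2)) ≤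
            (n - 1) * ((1 + h / 4) * (1 - h / 2)) := by
          (gcongr; linarith)
        have e5 : (1 + h * n / 4) * (1 - h / 2) + (n - 1) * ((1 + h / 4) * (1 - h / 2)) ≤ n := by
          nlinarith [mul_pos hh hh, mul_nonneg (mul_pos hh hh).le (by linarith : (0:ℝ) ≤ n)]
        calc _ = t * (Real.exp (h / 8 * n) * Real.exp (-h) +
              (n - 1) * (Real.exp (h / 8) * (1 - h / 2))) := by ring
          _ ≤ t * n := by
            gcongr
            exact (add_le_add e3 e4).trans e5
          _ = n * t := by ring
      · have := H.overrun_scan_le hs hset (k := k (b + 1 - n)) (b := b + 1 - n)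
          (e := t * Real.exp (h / 8 * n) * Real.exp (-h)) ?_
        · rwa [hbn] at this
        · intro s' i1 i2
          refine (hk _ s' i1 i2).trans (ENNReal.ofReal_le_ofReal ?_)
          rw [ht, tail, tail, ← Real.exp_add, ← Real.exp_add, Nat.cast_sub (by omega)]
          refine Real.exp_le_exp.mpr ?_
          push_cast
          linarith

theorem IsPotential.overrun_search_le (H : σ.IsPotential g f good Inv W h) (hh : 0 < h)
    (h1 : h ≤ 1) (hn : h * n ≤ 1) (k b : ℕ) (s : S) (hs : Inv s) :
    (σ.search k b s).overrun g f b ≤ ENNReal.ofReal (tail n h (W s) b) := by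
  induction k generalizing b s with
  | zero => rw [search, OracleAlg.overrun_halt]; exact zero_le
  | succ k ih =>
    rw [search, OracleAlg.overrun_gradient]
    rcases hset : σ.settle s (g (σ.point s)) with _ | (s' | x)
    · exact H.overrun_loop_le hh h1 hn hs hset (fun b s' i _ => ih b s' i) b
    · obtain ⟨i1, i2⟩ := H.settle_state s s' hs hset
      refine (ih b s' i1).trans (ENNReal.ofReal_le_ofReal (Real.exp_le_exp.mpr ?_))
      linarith
    · rw [OracleAlg.overrun_halt]
      exact zero_le

end SearchScheme

/-! ### Properties of ordered norms -/

section OrderedNorm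

variable {d : ℕ} {β : Fin d → ℝ}

lemma sortedAbs_antitone (x : Fin d → ℝ) : Antitone (sortedAbs x) := by
  intro i j hij
  have := Tuple.monotone_sort (fun j => -|x j|) hij
  simp only [Function.comp_apply] at this
  unfold sortedAbs
  linarith

lemma sum_sortedAbs (x : Fin d → ℝ) : ∑ i, sortedAbs x i = ∑ i, |x i| :=
  Equiv.sum_comp (Tuple.sort fun j => -|x j|) fun i => |x i|

lemma sum_mul_abs_perm_le_orderedNorm (hβ : Antitone β) (x : Fin d → ℝ)
    (π : Equiv.Perm (Fin d)) : ∑ i, β i * |x (π i)| ≤ orderedNorm β x := by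
  have hmono : Monovary β (sortedAbs x) := hβ.monovary (sortedAbs_antitone x)
  have := hmono.sum_mul_comp_perm_le_sum_mul (σ := π.trans (Tuple.sort fun j => -|x j|).symm)
  simpa [sortedAbs, orderedNorm] using this

lemma orderedNorm_add_le (hβ : IsOrderedWeight β) (x y : Fin d → ℝ) :
    orderedNorm β (x + y) ≤ orderedNorm β x + orderedNorm β y := by
  set π := Tuple.sort fun j => -|(x + y) j|
  calc orderedNorm β (x + y) = ∑ i, β i * |x (π i) + y (π i)| := rfl
    _ ≤ ∑ i, (β i * |x (π i)| + β i * |y (π i)|) := by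
        refine Finset.sum_le_sum fun i _ => ?_
        rw [← mul_add]
        exact mul_le_mul_of_nonneg_left (abs_add_le _ _) (hβ.nonneg i)
    _ = ∑ i, β i * |x (π i)| + ∑ i, β i * |y (π i)| := Finset.sum_add_distrib
    _ ≤ _ := add_le_add (sum_mul_abs_perm_le_orderedNorm hβ.antitone x π)
        (sum_mul_abs_perm_le_orderedNorm hβ.antitone y π)

lemma orderedNorm_smul_le (hβ : IsOrderedWeight β) {t : ℝ} (ht : 0 ≤ t) (x : Fin d → ℝ) :
    orderedNorm β (t • x) ≤ t * orderedNorm β x := by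
  set π := Tuple.sort fun j => -|(t • x) j|
  calc orderedNorm β (t • x) = ∑ i, β i * |t * x (π i)| := rfl
    _ = t * ∑ i, β i * |x (π i)| := by
        rw [Finset.mul_sum]
        refine Finset.sum_congr rfl fun i _ => ?_
        rw [abs_mul, abs_of_nonneg ht]
        ring
    _ ≤ _ := mul_le_mul_of_nonneg_left (sum_mul_abs_perm_le_orderedNorm hβ.antitone x π) ht

lemma sum_le_mul_orderedNorm (hβ : IsOrderedWeight β) (x : Fin d → ℝ) :
    ∑ i, x i ≤ d * orderedNorm β x := by
  have hmono : Monovary β (sortedAbs x) := hβ.antitone.monovary (sortedAbs_antitone x)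
  have := hmono.sum_mul_sum_le_card_mul_sum
  rw [hβ.sum_eq_one, one_mul, sum_sortedAbs, Fintype.card_fin] at this
  refine le_trans (Finset.sum_le_sum fun i _ => le_abs_self _) this

lemma orderedNorm_le_sum (hβ : IsOrderedWeight β) {x : Fin d → ℝ} (hx : x ∈ nonnegOrthant d) :
    orderedNorm β x ≤ ∑ i, x i := by
  calc orderedNorm β x ≤ ∑ i, sortedAbs x i := by
        refine Finset.sum_le_sum fun i _ => ?_
        have h1 : β i ≤ 1 := hβ.sum_eq_one ▸
          Finset.single_le_sum (fun j _ => hβ.nonneg j) (Finset.mem_univ i)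
        exact mul_le_of_le_one_left (abs_nonneg _) h1
    _ = ∑ i, x i := by
        rw [sum_sortedAbs]
        exact Finset.sum_congr rfl fun i _ => abs_of_nonneg (hx i)

lemma orderedNorm_nonneg (hβ : IsOrderedWeight β) (x : Fin d → ℝ) : 0 ≤ orderedNorm β x :=
  Finset.sum_nonneg fun i _ => mul_nonneg (hβ.nonneg i) (abs_nonneg _)

end OrderedNorm

/-! ### Properties of norm approximations -/

section Orthant

variable {d : ℕ}

lemma convex_nonnegOrthant : Convex ℝ (nonnegOrthant d) := by
  intro x hx y hy a b ha hb _ i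
  exact add_nonneg (mul_nonneg ha (hx i)) (mul_nonneg hb (hy i))

lemma zero_mem_nonnegOrthant : (0 : Fin d → ℝ) ∈ nonnegOrthant d := fun _ => le_rfl

lemma add_mem_nonnegOrthant {x y : Fin d → ℝ} (hx : x ∈ nonnegOrthant d)
    (hy : y ∈ nonnegOrthant d) : x + y ∈ nonnegOrthant d := fun i => add_nonneg (hx i) (hy i)

lemma smul_mem_nonnegOrthant {x : Fin d → ℝ} {t : ℝ} (ht : 0 ≤ t) (hx : x ∈ nonnegOrthant d) :
    t • x ∈ nonnegOrthant d := fun i => mul_nonneg ht (hx i)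

lemma sum_mem_nonnegOrthant {ι : Type*} {s : Finset ι} {x : ι → Fin d → ℝ}
    (hx : ∀ c ∈ s, x c ∈ nonnegOrthant d) : ∑ c ∈ s, x c ∈ nonnegOrthant d := by
  intro i
  rw [Finset.sum_apply]
  exact Finset.sum_nonneg fun c hc => hx c hc i

lemma dotProduct_nonneg_of_mem {p x : Fin d → ℝ} (hp : p ∈ nonnegOrthant d)
    (hx : x ∈ nonnegOrthant d) : 0 ≤ p ⬝ᵥ x :=
  Finset.sum_nonneg fun i _ => mul_nonneg (hp i) (hx i)

lemma norm_le_sum_of_mem {x : Fin d → ℝ} (hx : x ∈ nonnegOrthant d) : ‖x‖ ≤ ∑ i, x i := by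
  refine (pi_norm_le_iff_of_nonneg (Finset.sum_nonneg fun i _ => hx i)).mpr fun i => ?_
  rw [Real.norm_eq_abs, abs_of_nonneg (hx i)]
  exact Finset.single_le_sum (fun j _ => hx j) (Finset.mem_univ i)

end Orthant

namespace IsNormApproximation

variable {d : ℕ} {δ η : ℝ} {β : Fin d → ℝ} {Ψ : (Fin d → ℝ) → ℝ}

lemma orthantGradient_dotProduct (Ψ : (Fin d → ℝ) → ℝ) (s v : Fin d → ℝ) :
    orthantGradient Ψ s ⬝ᵥ v = fderivWithin ℝ Ψ (nonnegOrthant d) s v := by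
  conv_rhs => rw [← Finset.univ_sum_single v, map_sum]
  refine Finset.sum_congr rfl fun i _ => ?_
  have : (Pi.single i (v i) : Fin d → ℝ) = v i • Pi.single i 1 := by
    rw [← Pi.single_smul, smul_eq_mul, mul_one]
  rw [this, map_smul, smul_eq_mul, mul_comm, orthantGradient]

lemma add_dotProduct_le (H : IsNormApproximation δ η β Ψ) {s z : Fin d → ℝ}
    (hs : s ∈ nonnegOrthant d) (hz : z ∈ nonnegOrthant d) :
    Ψ s + orthantGradient Ψ s ⬝ᵥ (z - s) ≤ Ψ z := by
  rw [orthantGradient_dotProduct]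
  set ℓ : ℝ →ᵃ[ℝ] (Fin d → ℝ) := AffineMap.lineMap s z with hℓ
  have hmaps : Set.MapsTo ℓ (Set.Icc 0 1) (nonnegOrthant d) := fun t ht =>
    convex_nonnegOrthant.lineMap_mem hs hz ht
  have hconv : ConvexOn ℝ (Set.Icc (0 : ℝ) 1) (Ψ ∘ ℓ) :=
    (H.convexOn.comp_affineMap ℓ).subset hmaps (convex_Icc 0 1)
  have hd : HasFDerivWithinAt Ψ (fderivWithin ℝ Ψ (nonnegOrthant d) s) (nonnegOrthant d) (ℓ 0) := by
    rw [hℓ, AffineMap.lineMap_apply_zero]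
    exact (H.differentiableOn s hs).hasFDerivWithinAt
  have hder : HasDerivWithinAt (Ψ ∘ ℓ) (fderivWithin ℝ Ψ (nonnegOrthant d) s (z - s))
      (Set.Icc 0 1) 0 :=
    hd.comp_hasDerivWithinAt 0 AffineMap.hasDerivWithinAt_lineMap hmaps
  have := hconv.le_slope_of_hasDerivWithinAt (Set.left_mem_Icc.mpr zero_le_one)
    (Set.right_mem_Icc.mpr zero_le_one) one_pos hder
  rw [slope_def_field] at this
  simp only [hℓ, Function.comp_apply, AffineMap.lineMap_apply_one, AffineMap.lineMap_apply_zero,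
    sub_zero, div_one] at this
  linarith

lemma gradient_mem (H : IsNormApproximation δ η β Ψ) (hη : 0 ≤ η) {s : Fin d → ℝ}
    (hs : s ∈ nonnegOrthant d) : orthantGradient Ψ s ∈ nonnegOrthant d := by
  intro i
  by_contra! hneg
  set a := orthantGradient Ψ s i
  set t : ℝ := (Ψ s + 1) / (-a) with ht
  have hΨ := H.nonneg s hs
  have ht0 : 0 < t := div_pos (by linarith) (by linarith)
  have hy : (Pi.single i t : Fin d → ℝ) ∈ nonnegOrthant d := by
    intro j
    by_cases hj : j = i
    · subst hj
      simp [ht0.le]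
    · simp [hj]
  have h1 := H.gradient_le s hs _ hy i
  have h2 := H.add_dotProduct_le (add_mem_nonnegOrthant hs hy) hs
  have h3 := H.nonneg _ (add_mem_nonnegOrthant hs hy)
  have h4 : s - (s + Pi.single i t) = -Pi.single i t := by abel
  rw [h4, dotProduct_neg, dotProduct_single] at h2
  have h5 : 1 ≤ Real.exp (η * ‖(Pi.single i t : Fin d → ℝ)‖) :=
    Real.one_le_exp (mul_nonneg hη (norm_nonneg _))
  have h6 : orthantGradient Ψ (s + Pi.single i t) i ≤ a := by nlinarith
  have h7 : t * -a = Ψ s + 1 := div_mul_cancel₀ _ (by linarith)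
  nlinarith

lemma dotProduct_le_orderedNorm (H : IsNormApproximation δ η β Ψ) (hβ : IsOrderedWeight β)
    {s x : Fin d → ℝ} (hs : s ∈ nonnegOrthant d) (hx : x ∈ nonnegOrthant d) :
    orthantGradient Ψ s ⬝ᵥ x ≤ orderedNorm β x := by
  by_contra! hlt
  set D := orthantGradient Ψ s ⬝ᵥ x - orderedNorm β x with hD
  have hD0 : 0 < D := by linarith
  have hδ := (H.norm_le s hs).trans (H.le_norm_add s hs)
  set t : ℝ := (δ + 1) / D with ht
  have ht0 : 0 ≤ t := div_nonneg (by linarith) hD0.le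
  have hsx := add_mem_nonnegOrthant hs (smul_mem_nonnegOrthant ht0 hx)
  have h1 := H.add_dotProduct_le hs hsx
  rw [add_sub_cancel_left, dotProduct_smul, smul_eq_mul] at h1
  have h2 := H.le_norm_add _ hsx
  have h3 := orderedNorm_add_le hβ s (t • x)
  have h4 := orderedNorm_smul_le hβ ht0 x
  have h5 := H.norm_le s hs
  have h6 : t * D = δ + 1 := div_mul_cancel₀ _ hD0.ne'
  rw [hD] at h6
  nlinarith

lemma sub_le_dotProduct_self (H : IsNormApproximation δ η β Ψ) (hβ : IsOrderedWeight β)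
    {s : Fin d → ℝ} (hs : s ∈ nonnegOrthant d) : Ψ s - δ ≤ orthantGradient Ψ s ⬝ᵥ s := by
  have h1 := H.add_dotProduct_le hs zero_mem_nonnegOrthant
  have h2 := H.le_norm_add 0 zero_mem_nonnegOrthant
  have h3 := orderedNorm_le_sum hβ (zero_mem_nonnegOrthant (d := d))
  simp only [Pi.zero_apply, Finset.sum_const_zero] at h3
  rw [zero_sub, dotProduct_neg] at h1
  linarith

lemma dotProduct_le_exp_mul (H : IsNormApproximation δ η β Ψ) {s y v : Fin d → ℝ}
    (hs : s ∈ nonnegOrthant d) (hy : y ∈ nonnegOrthant d) (hv : v ∈ nonnegOrthant d) :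
    orthantGradient Ψ (s + y) ⬝ᵥ v ≤ Real.exp (η * ‖y‖) * (orthantGradient Ψ s ⬝ᵥ v) := by
  rw [dotProduct, dotProduct, Finset.mul_sum]
  refine Finset.sum_le_sum fun i _ => ?_
  rw [← mul_assoc]
  exact mul_le_mul_of_nonneg_right (H.gradient_le s hs y hy i) (hv i)

/-- Moving from `s` to `s - u + v`, where `u` and `v` are small, changes `Ψ` by roughly the value of
`v - u` at the current prices. -/
lemma exchange_le (H : IsNormApproximation δ η β Ψ) (hη : 0 ≤ η) {s u v : Fin d → ℝ} {m : ℝ}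
    (hs : s ∈ nonnegOrthant d) (hu : u ∈ nonnegOrthant d) (hv : v ∈ nonnegOrthant d)
    (hsu : s - (2 : ℝ) • u ∈ nonnegOrthant d) (hum : ‖u‖ ≤ m) (hvm : ‖v‖ ≤ m)
    (hm : 2 * (η * m) ≤ 1) :
    Ψ (s + (v - u)) ≤ Ψ s + (1 + 4 * (η * m)) * (orthantGradient Ψ s ⬝ᵥ v) -
      (1 - 4 * (η * m)) * (orthantGradient Ψ s ⬝ᵥ u) := by
  have hm0 : 0 ≤ m := (norm_nonneg u).trans hum
  have hx0 : 0 ≤ 2 * (η * m) := by positivity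
  have h2u := smul_mem_nonnegOrthant zero_le_two hu
  have h2v := smul_mem_nonnegOrthant zero_le_two hv
  have hsv := add_mem_nonnegOrthant hs h2v
  have hpu := dotProduct_nonneg_of_mem (H.gradient_mem hη hs) hu
  have hpv := dotProduct_nonneg_of_mem (H.gradient_mem hη hs) hv
  have hexp : Real.exp (2 * (η * m)) ≤ 1 + 2 * (2 * (η * m)) :=
    SearchScheme.exp_le_one_add_two_mul hx0 hm
  have hexp' : 1 - 2 * (η * m) ≤ Real.exp (-(2 * (η * m))) := by
    linarith [Real.add_one_le_exp (-(2 * (η * m)))]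
  have hnorm : ∀ x : Fin d → ℝ, ‖x‖ ≤ m →
      Real.exp (η * ‖(2 : ℝ) • x‖) ≤ Real.exp (2 * (η * m)) := by
    intro x hx
    rw [Real.exp_le_exp, norm_smul, Real.norm_two]
    nlinarith
  have hmid : Ψ (s + (v - u)) ≤ (1 / 2) * Ψ (s + (2 : ℝ) • v) + (1 / 2) * Ψ (s - (2 : ℝ) • u) := by
    have := H.convexOn.2 hsv hsu (by norm_num : (0 : ℝ) ≤ 1 / 2) (by norm_num : (0 : ℝ) ≤ 1 / 2)
      (by norm_num)
    simp only [smul_eq_mul] at this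
    refine le_trans (le_of_eq (congrArg Ψ ?_)) this
    ext i
    simp
    ring
  have hup : Ψ (s + (2 : ℝ) • v) ≤ Ψ s + 2 * ((1 + 4 * (η * m)) * (orthantGradient Ψ s ⬝ᵥ v)) := by
    have h1 := H.add_dotProduct_le hsv hs
    have h2 := H.dotProduct_le_exp_mul hs h2v hv
    rw [sub_add_cancel_left, dotProduct_neg, dotProduct_smul, smul_eq_mul] at h1
    have h3 : Real.exp (η * ‖(2 : ℝ) • v‖) * (orthantGradient Ψ s ⬝ᵥ v) ≤
        (1 + 4 * (η * m)) * (orthantGradient Ψ s ⬝ᵥ v) := by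
      gcongr
      linarith [hnorm v hvm]
    linarith
  have hdown : Ψ (s - (2 : ℝ) • u) ≤ Ψ s - 2 * ((1 - 4 * (η * m)) * (orthantGradient Ψ s ⬝ᵥ u)) := by
    have h1 := H.add_dotProduct_le hsu hs
    have h2 := H.dotProduct_le_exp_mul hsu h2u hu
    rw [sub_sub_cancel, dotProduct_smul, smul_eq_mul] at h1
    rw [sub_add_cancel] at h2
    have h0 := dotProduct_nonneg_of_mem (H.gradient_mem hη hsu) hu
    have h3 : orthantGradient Ψ s ⬝ᵥ u ≤
        Real.exp (2 * (η * m)) * (orthantGradient Ψ (s - (2 : ℝ) • u) ⬝ᵥ u) :=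
      h2.trans (mul_le_mul_of_nonneg_right (hnorm u hum) h0)
    have h4 : Real.exp (-(2 * (η * m))) * (orthantGradient Ψ s ⬝ᵥ u) ≤
        orthantGradient Ψ (s - (2 : ℝ) • u) ⬝ᵥ u := by
      rw [Real.exp_neg, inv_mul_le_iff₀ (Real.exp_pos _)]
      exact h3
    have h5 : (1 - 4 * (η * m)) * (orthantGradient Ψ s ⬝ᵥ u) ≤
        Real.exp (-(2 * (η * m))) * (orthantGradient Ψ s ⬝ᵥ u) := by
      gcongr
      linarith
    linarith
  linarith

end IsNormApproximation

/-- A closed set of non-negative vectors contains a vector of least value, if prices are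
positive. -/
lemma exists_isLeast_dotProduct {d : ℕ} {Y : Set (Fin d → ℝ)} (hne : Y.Nonempty)
    (hcl : IsClosed Y) (hsub : Y ⊆ nonnegOrthant d) {y : Fin d → ℝ} (hy : ∀ i, 0 < y i) :
    ∃ x ∈ Y, ∀ x' ∈ Y, y ⬝ᵥ x ≤ y ⬝ᵥ x' := by
  obtain ⟨x₀, hx₀⟩ := hne
  have hcont : Continuous fun x : Fin d → ℝ => y ⬝ᵥ x :=
    continuous_finsetSum _ fun i _ => continuous_const.mul (continuous_apply i)
  set K := Y ∩ {x | y ⬝ᵥ x ≤ y ⬝ᵥ x₀} with hK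
  have hKcl : IsClosed K := hcl.inter (isClosed_le hcont continuous_const)
  have hKsub : K ⊆ Set.Icc 0 (fun i => (y ⬝ᵥ x₀) / y i) := by
    intro x hx
    refine ⟨hsub hx.1, fun i => ?_⟩
    rw [le_div_iff₀ (hy i), mul_comm]
    refine le_trans ?_ hx.2
    exact Finset.single_le_sum (f := fun i => y i * x i)
      (fun j _ => mul_nonneg (hy j).le (hsub hx.1 j)) (Finset.mem_univ i)
  have hKc : IsCompact K := isCompact_Icc.of_isClosed_subset hKcl hKsub
  obtain ⟨x, hx, hmin⟩ := hKc.exists_isMinOn ⟨x₀, hx₀, le_refl (y ⬝ᵥ x₀)⟩ hcont.continuousOn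
  refine ⟨x, hx.1, fun x' hx' => ?_⟩
  rcases le_or_gt (y ⬝ᵥ x') (y ⬝ᵥ x₀) with h | h
  · exact hmin ⟨hx', h⟩
  · exact hx.2.trans h.le

/-! ### One step of the local search -/

section Step

variable {n d : ℕ}

/-- The prices at which oracles are called: a multiple of the gradient `p`, plus a uniform term. -/
noncomputable def stepPrice (w ε : ℝ) (p : Fin d → ℝ) : Fin d → ℝ := fun i => w * p i + ε / 2 / d

/-- The first-order gain of replacing the load `a` of a customer by `b`. -/
noncomputable def stepGain (w ε : ℝ) (p a b : Fin d → ℝ) : ℝ :=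
  w * (p ⬝ᵥ a - p ⬝ᵥ b) + ε / 4 * ((∑ i, a i - ∑ i, b i) / d)

/-- The cost of the load `a` of a customer. -/
noncomputable def stepCost (w : ℝ) (p a : Fin d → ℝ) : ℝ := w * (p ⬝ᵥ a) + (∑ i, a i) / d

/-- The weight with which a customer of load `a` is sampled. -/
noncomputable def stepWeight (w : ℝ) (p a : Fin d → ℝ) : ℝ := d * stepCost w p a + 1

/-- The width of a step from `a` towards `b`. -/
noncomputable def stepWidth (w : ℝ) (p a b : Fin d → ℝ) : ℝ := max (stepWeight w p a) (∑ i, b i)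

/-- The length of a step from `a` towards `b`. -/
noncomputable def stepLength (η w ε T : ℝ) (p a b : Fin d → ℝ) : ℝ :=
  stepGain w ε p a b / (16 * η * stepCost w p a) / (T * stepWidth w p a b)

/-- The guaranteed progress of a step from `a` towards `b`. -/
noncomputable def stepProgress (η w ε T : ℝ) (p a b : Fin d → ℝ) : ℝ :=
  stepGain w ε p a b ^ 2 / (32 * (η * T) * stepCost w p a * stepWidth w p a b)

/-- The potential of a load `z`. -/
noncomputable def loadPotential (Ψ : (Fin d → ℝ) → ℝ) (w ε T : ℝ) (z : Fin d → ℝ) : ℝ :=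
  w / T * Ψ (T • z) + ε / 4 * ((∑ i, z i) / d)

/-- The loads of the customers after a step of customer `c` towards `b`. -/
noncomputable def stepLoads (η w ε T : ℝ) (p : Fin d → ℝ) (x : Fin n → Fin d → ℝ) (c : Fin n)
    (b : Fin d → ℝ) : Fin n → Fin d → ℝ :=
  Function.update x c ((1 - stepLength η w ε T p (x c) b) • x c +
    stepLength η w ε T p (x c) b • b)

variable {η w ε T : ℝ} {p a b : Fin d → ℝ}

lemma stepPrice_dotProduct (w ε : ℝ) (p v : Fin d → ℝ) :
    stepPrice w ε p ⬝ᵥ v = w * (p ⬝ᵥ v) + ε / 2 * ((∑ i, v i) / d) := by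
  simp only [dotProduct, stepPrice, add_mul, Finset.sum_add_distrib]
  rw [Finset.mul_sum, ← Finset.mul_sum]
  congr 1
  · exact Finset.sum_congr rfl fun i _ => by ring
  · ring

lemma stepCost_nonneg (hw : 0 ≤ w) (hp : p ∈ nonnegOrthant d) (ha : a ∈ nonnegOrthant d) :
    0 ≤ stepCost w p a :=
  add_nonneg (mul_nonneg hw (dotProduct_nonneg_of_mem hp ha))
    (div_nonneg (Finset.sum_nonneg fun i _ => ha i) (Nat.cast_nonneg d))

lemma one_le_stepWeight (hw : 0 ≤ w) (hp : p ∈ nonnegOrthant d) (ha : a ∈ nonnegOrthant d) :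
    1 ≤ stepWeight w p a := by
  have := mul_nonneg (Nat.cast_nonneg (α := ℝ) d) (stepCost_nonneg hw hp ha)
  unfold stepWeight
  linarith

lemma sum_le_stepWeight (hd : 0 < d) (hw : 0 ≤ w) (hp : p ∈ nonnegOrthant d)
    (ha : a ∈ nonnegOrthant d) : ∑ i, a i ≤ stepWeight w p a := by
  have hd' : (0 : ℝ) < d := by exact_mod_cast hd
  have h1 := mul_nonneg hw (dotProduct_nonneg_of_mem hp ha)
  have h2 : d * ((∑ i, a i) / d) = ∑ i, a i := by field_simp
  unfold stepWeight stepCost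
  nlinarith

lemma stepGain_le_stepCost (hw : 0 ≤ w) (hε : 0 ≤ ε) (hε1 : ε ≤ 1) (hp : p ∈ nonnegOrthant d)
    (ha : a ∈ nonnegOrthant d) (hb : b ∈ nonnegOrthant d) :
    stepGain w ε p a b ≤ stepCost w p a := by
  have h1 := mul_nonneg hw (dotProduct_nonneg_of_mem hp hb)
  have h2 : 0 ≤ (∑ i, b i) / d := div_nonneg (Finset.sum_nonneg fun i _ => hb i) d.cast_nonneg
  have h3 : 0 ≤ (∑ i, a i) / d := div_nonneg (Finset.sum_nonneg fun i _ => ha i) d.cast_nonneg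
  have h4 : ε / 4 * ((∑ i, a i) / d) ≤ 1 * ((∑ i, a i) / d) := by
    gcongr
    linarith
  unfold stepGain stepCost
  rw [sub_div]
  nlinarith [mul_nonneg hε h2]

lemma stepWidth_pos (hw : 0 ≤ w) (hp : p ∈ nonnegOrthant d) (ha : a ∈ nonnegOrthant d) :
    0 < stepWidth w p a b :=
  lt_of_lt_of_le one_pos ((one_le_stepWeight hw hp ha).trans (le_max_left _ _))

lemma stepLength_bounds (hη : 0 < η) (hw : 0 ≤ w) (hε : 0 ≤ ε) (hε1 : ε ≤ 1) (hT : 4 ≤ η * T)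
    (hp : p ∈ nonnegOrthant d) (ha : a ∈ nonnegOrthant d) (hb : b ∈ nonnegOrthant d)
    (hgain : 0 < stepGain w ε p a b) :
    0 ≤ stepLength η w ε T p a b ∧ stepLength η w ε T p a b ≤ 1 / 2 := by
  have hle := stepGain_le_stepCost hw hε hε1 hp ha hb
  have hcost : 0 < stepCost w p a := hgain.trans_le hle
  have hwid : 1 ≤ stepWidth w p a b := (one_le_stepWeight hw hp ha).trans (le_max_left _ _)
  have hT0 : 0 < T := by
    by_contra! h
    nlinarith
  have heq : stepLength η w ε T p a b =
      stepGain w ε p a b / (16 * (η * T) * stepCost w p a * stepWidth w p a b) := by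
    unfold stepLength
    rw [div_div]
    ring_nf
  rw [heq]
  refine ⟨by positivity, ?_⟩
  rw [div_le_iff₀ (by positivity)]
  have h1 : stepCost w p a ≤ stepCost w p a * stepWidth w p a b := le_mul_of_one_le_right hcost.le hwid
  nlinarith

/-- The potential drops by at least the guaranteed progress of a step. -/
lemma loadPotential_step_le {δ : ℝ} {β : Fin d → ℝ} {Ψ : (Fin d → ℝ) → ℝ}
    (H : IsNormApproximation δ η β Ψ) (hd : 0 < d) (hη : 0 < η) (hw : 0 ≤ w) (hε : 0 ≤ ε)
    (hε1 : ε ≤ 1) (hT : 4 ≤ η * T) {x : Fin n → Fin d → ℝ} (hx : ∀ c, x c ∈ nonnegOrthant d)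
    (hp : p = orthantGradient Ψ (T • ∑ c, x c)) (c : Fin n) (hb : b ∈ nonnegOrthant d)
    (hmin : stepPrice w ε p ⬝ᵥ b ≤ stepPrice w ε p ⬝ᵥ x c)
    (hgain : 0 < stepGain w ε p (x c) b) :
    loadPotential Ψ w ε T (∑ c', stepLoads η w ε T p x c b c') ≤
      loadPotential Ψ w ε T (∑ c, x c) - stepProgress η w ε T p (x c) b := by
  have hT0 : 0 < T := by
    by_contra! h
    nlinarith
  set z := ∑ c, x c with hz
  have hzmem : z ∈ nonnegOrthant d := sum_mem_nonnegOrthant fun c _ => hx c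
  have hs : T • z ∈ nonnegOrthant d := smul_mem_nonnegOrthant hT0.le hzmem
  have hpm : p ∈ nonnegOrthant d := hp ▸ H.gradient_mem hη.le hs
  obtain ⟨hξ0, hξ1⟩ := stepLength_bounds hη hw hε hε1 hT hpm (hx c) hb hgain
  have hle := stepGain_le_stepCost hw hε hε1 hpm (hx c) hb
  have hwid := stepWidth_pos (b := b) hw hpm (hx c)
  set G := stepGain w ε p (x c) b with hG
  set v := stepCost w p (x c) with hv
  set D := stepWidth w p (x c) b with hD
  set ξ := stepLength η w ε T p (x c) b with hξ
  have hv0 : 0 < v := hgain.trans_le hle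
  have hsum : ∑ c', stepLoads η w ε T p x c b c' = z + ξ • (b - x c) := by
    rw [stepLoads, Finset.sum_update_of_mem (Finset.mem_univ c), hz,
      ← Finset.add_sum_erase _ _ (Finset.mem_univ c), ← Finset.erase_eq]
    module
  set m := G / (16 * η * v) with hm
  have hm0 : 0 ≤ m := by positivity
  have hηm : η * m = G / v / 16 := by
    rw [hm]
    field_simp
  have hρ : G / v ≤ 1 := (div_le_one hv0).mpr hle
  have hTξ : T * ξ = m / D := by
    rw [hξ, stepLength, ← hG, ← hv, ← hD, ← hm]
    field_simp
  have hsmall : ∀ y ∈ nonnegOrthant d, ∑ i, y i ≤ D → ‖(T * ξ) • y‖ ≤ m := by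
    intro y hy hyD
    rw [hTξ, norm_smul, Real.norm_of_nonneg (by positivity), div_mul_eq_mul_div, div_le_iff₀ hwid]
    exact mul_le_mul_of_nonneg_left ((norm_le_sum_of_mem hy).trans hyD) hm0
  have hrest : T • z - (2 : ℝ) • ((T * ξ) • x c) ∈ nonnegOrthant d := by
    have h1 : T • z - (2 : ℝ) • ((T * ξ) • x c) =
        T • ((∑ c' ∈ Finset.univ.erase c, x c') + (1 - 2 * ξ) • x c) := by
      rw [hz, ← Finset.add_sum_erase _ _ (Finset.mem_univ c)]
      module
    rw [h1]
    exact smul_mem_nonnegOrthant hT0.le (add_mem_nonnegOrthant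
      (sum_mem_nonnegOrthant fun c' _ => hx c') (smul_mem_nonnegOrthant (by linarith) (hx c)))
  have hex := H.exchange_le hη.le hs (smul_mem_nonnegOrthant (mul_nonneg hT0.le hξ0) (hx c))
    (smul_mem_nonnegOrthant (mul_nonneg hT0.le hξ0) hb) hrest
    (hsmall _ (hx c) ((sum_le_stepWeight hd hw hpm (hx c)).trans (le_max_left _ _)))
    (hsmall _ hb (le_max_right _ _)) (by rw [hηm]; linarith)
  rw [← hp, dotProduct_smul, dotProduct_smul, smul_eq_mul, smul_eq_mul] at hex
  have hpt : T • (z + ξ • (b - x c)) = T • z + ((T * ξ) • b - (T * ξ) • x c) := by module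
  have hlin : (∑ i, (z + ξ • (b - x c)) i) / d =
      (∑ i, z i) / d - ξ * ((∑ i, x c i - ∑ i, b i) / d) := by
    simp only [Pi.add_apply, Pi.smul_apply, Pi.sub_apply, smul_eq_mul, Finset.sum_add_distrib,
      ← Finset.mul_sum, Finset.sum_sub_distrib]
    ring
  have hpb := mul_nonneg hw (dotProduct_nonneg_of_mem hpm hb)
  have hpx := mul_nonneg hw (dotProduct_nonneg_of_mem hpm (hx c))
  have hqx : 0 ≤ (∑ i, x c i) / d :=
    div_nonneg (Finset.sum_nonneg fun i _ => hx c i) d.cast_nonneg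
  have hqb : 0 ≤ (∑ i, b i) / d :=
    div_nonneg (Finset.sum_nonneg fun i _ => hb i) d.cast_nonneg
  rw [stepPrice_dotProduct, stepPrice_dotProduct] at hmin
  have hbv : w * (p ⬝ᵥ b) ≤ v := by
    rw [hv, stepCost]
    nlinarith [mul_nonneg hε hqb, mul_nonneg hε hqx]
  have hxv : w * (p ⬝ᵥ x c) ≤ v := by
    rw [hv, stepCost]
    linarith
  have herr : 4 * (η * m) * (w * (p ⬝ᵥ b) + w * (p ⬝ᵥ x c)) ≤ G / 2 := by
    rw [hηm]
    calc 4 * (G / v / 16) * (w * (p ⬝ᵥ b) + w * (p ⬝ᵥ x c)) ≤ 4 * (G / v / 16) * (v + v) := by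
          gcongr
      _ = G / 2 := by field_simp; norm_num
  have hprog : stepProgress η w ε T p (x c) b = ξ * (G / 2) := by
    rw [hξ, stepProgress, stepLength, ← hG, ← hv, ← hD]
    field_simp
    norm_num
  rw [hsum, loadPotential, loadPotential, hpt, hlin, hprog]
  have hmul := mul_le_mul_of_nonneg_left hex (div_nonneg hw hT0.le)
  have hcancel : w / T * T = w := by field_simp
  have hξmul := mul_le_mul_of_nonneg_left herr hξ0
  have hGeq : G = w * (p ⬝ᵥ x c - p ⬝ᵥ b) + ε / 4 * ((∑ i, x c i - ∑ i, b i) / d) := rfl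
  have hexpand : w / T * (Ψ (T • z) + (1 + 4 * (η * m)) * (T * ξ * (p ⬝ᵥ b)) -
      (1 - 4 * (η * m)) * (T * ξ * (p ⬝ᵥ x c))) = w / T * Ψ (T • z) +
      (w / T * T) * ξ * ((p ⬝ᵥ b - p ⬝ᵥ x c) + 4 * (η * m) * (p ⬝ᵥ b + p ⬝ᵥ x c)) := by ring
  rw [hexpand, hcancel] at hmul
  have hfin : ξ * (4 * (η * m) * (w * (p ⬝ᵥ b) + w * (p ⬝ᵥ x c))) ≤
      ξ * G - ξ * (G / 2) := by linarith
  nth_rewrite 1 [hGeq] at hfin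
  linarith

lemma stepProgress_le (hd : 0 < d) (hw : 0 ≤ w) (hε : 0 ≤ ε) (hε1 : ε ≤ 1)
    (hT : 4 ≤ η * T) (hp : p ∈ nonnegOrthant d) (ha : a ∈ nonnegOrthant d)
    (hb : b ∈ nonnegOrthant d) (hgain : 0 < stepGain w ε p a b) :
    stepProgress η w ε T p a b ≤ 1 / (32 * (η * T)) := by
  have hle := stepGain_le_stepCost hw hε hε1 hp ha hb
  have hcost : 0 < stepCost w p a := hgain.trans_le hle
  have hwid := stepWidth_pos (b := b) hw hp ha
  have hd' : (1 : ℝ) ≤ d := by exact_mod_cast hd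
  have hcw : stepCost w p a ≤ stepWidth w p a b := by
    refine le_trans ?_ (le_max_left _ _)
    unfold stepWeight
    nlinarith
  rw [stepProgress, div_le_div_iff₀ (by positivity) (by positivity)]
  have : stepGain w ε p a b ^ 2 ≤ stepCost w p a * stepWidth w p a b := by
    nlinarith
  nlinarith

/-- The progress of a customer, times the weight of this customer, is bounded from below by its
gain. -/
lemma mul_gain_sub_le (hd : 0 < d) (hη : 0 < η) (hw : 0 ≤ w) (hε : 0 ≤ ε)
    (hT : 4 ≤ η * T) (hp : p ∈ nonnegOrthant d) (ha : a ∈ nonnegOrthant d)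
    (hb : b ∈ nonnegOrthant d) (hmin : stepPrice w ε p ⬝ᵥ b ≤ stepPrice w ε p ⬝ᵥ a)
    {τ : ℝ} (hτ0 : 0 ≤ τ) (hτ : τ ≤ ε / 8) :
    τ * stepGain w ε p a b - τ ^ 2 / 2 * stepCost w p a ≤
      32 * (η * T) * (stepWeight w p a *
        if 0 < stepGain w ε p a b then stepProgress η w ε T p a b else 0) := by
  have hcost0 := stepCost_nonneg hw hp ha
  split_ifs with hgain
  swap
  · rw [mul_zero, mul_zero]
    nlinarith [sq_nonneg τ]
  have hd' : (0 : ℝ) < d := by exact_mod_cast hd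
  have hwt := one_le_stepWeight hw hp ha
  have hsum := sum_le_stepWeight hd hw hp ha
  have hηT : 0 < η * T := by linarith
  have hT0 : 0 < T := pos_of_mul_pos_right hηT hη.le
  rcases hcost0.eq_or_lt with hcost | hcost
  · have h1 : stepProgress η w ε T p a b = 0 := by
      rw [stepProgress, ← hcost]
      simp
    have hpa := mul_nonneg hw (dotProduct_nonneg_of_mem hp ha)
    have hpb := mul_nonneg hw (dotProduct_nonneg_of_mem hp hb)
    have hqa : 0 ≤ (∑ i, a i) / d :=
      div_nonneg (Finset.sum_nonneg fun i _ => ha i) d.cast_nonneg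
    have hqb : 0 ≤ (∑ i, b i) / d :=
      div_nonneg (Finset.sum_nonneg fun i _ => hb i) d.cast_nonneg
    have h2 : stepGain w ε p a b ≤ 0 := by
      unfold stepCost at hcost
      have e1 : w * (p ⬝ᵥ a) = 0 := by linarith
      have e2 : (∑ i, a i) / d = 0 := by linarith
      unfold stepGain
      rw [sub_div, e2]
      nlinarith [mul_nonneg hε hqb]
    linarith
  set G := stepGain w ε p a b with hG
  set v := stepCost w p a with hv
  set lam := stepWeight w p a with hlam
  have hwid := stepWidth_pos (b := b) hw hp ha
  have heq : 32 * (η * T) * (lam * stepProgress η w ε T p a b) =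
      G ^ 2 / v * (lam / stepWidth w p a b) := by
    rw [stepProgress, ← hG, ← hv]
    field_simp
  rw [heq]
  rcases le_or_gt (∑ i, b i) (2 * lam) with hbl | hbl
  · have h1 : 1 / 2 ≤ lam / stepWidth w p a b := by
      rw [div_le_div_iff₀ two_pos hwid, one_mul, mul_comm]
      exact max_le (by linarith) hbl
    have h2 : τ * G - τ ^ 2 / 2 * v ≤ G ^ 2 / v * (1 / 2) := by
      rw [div_mul_eq_mul_div (G ^ 2), le_div_iff₀ hcost]
      nlinarith [sq_nonneg (G - τ * v)]
    refine h2.trans ?_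
    gcongr
  · have hDb : stepWidth w p a b = ∑ i, b i := max_eq_right (by linarith)
    have hb0 : 0 < ∑ i, b i := by linarith
    rw [hDb]
    have h1 : ε / 8 * ((∑ i, b i) / d) ≤ G := by
      rw [stepPrice_dotProduct, stepPrice_dotProduct] at hmin
      have e1 : (∑ i, a i) / d ≤ (∑ i, b i) / d / 2 := by
        rw [div_div, mul_comm, ← div_div]
        gcongr
        linarith
      have e2 : ε / 4 * ((∑ i, a i) / d) ≤ ε / 4 * ((∑ i, b i) / d / 2) := by gcongr
      rw [hG, stepGain, sub_div]
      nlinarith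
    have h2 : d * v ≤ lam := by
      rw [hlam, stepWeight]
      linarith
    calc τ * G - τ ^ 2 / 2 * v ≤ τ * G := by nlinarith [sq_nonneg τ]
      _ ≤ ε / 8 * G := by gcongr
      _ = G * (ε / 8 * ((∑ i, b i) / d)) / v * (d * v / ∑ i, b i) := by field_simp
      _ ≤ G * G / v * (lam / ∑ i, b i) := by gcongr
      _ = G ^ 2 / v * (lam / ∑ i, b i) := by ring

/-- If the current load costs much more than the answers of the oracles, then the expected progress
of a random customer is large. -/
lemma expected_progress (hd : 0 < d) (hη : 0 < η) (hw : 0 ≤ w) (hε : 0 ≤ ε)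
    (hT : 4 ≤ η * T) (hp : p ∈ nonnegOrthant d) {x b : Fin n → Fin d → ℝ}
    (hx : ∀ c, x c ∈ nonnegOrthant d) (hb : ∀ c, b c ∈ nonnegOrthant d)
    (hmin : ∀ c, stepPrice w ε p ⬝ᵥ b c ≤ stepPrice w ε p ⬝ᵥ x c)
    (hsmall : ∑ c, stepPrice w ε p ⬝ᵥ b c ≤ w + ε / 2)
    (hlarge : w + 2 * ε ≤ w * (p ⬝ᵥ ∑ c, x c) + ε / 4 * ((∑ i, (∑ c, x c) i) / d))
    (hcost : ∑ c, stepCost w p (x c) ≤ 32) {μ : ℝ} (hμ0 : 0 ≤ μ)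
    (hμ : μ * (65536 * (η * T) * (n + d)) ≤ ε ^ 2) :
    μ * ∑ c, stepWeight w p (x c) ≤ ∑ c, stepWeight w p (x c) *
      if 0 < stepGain w ε p (x c) (b c) ∧ μ ≤ stepProgress η w ε T p (x c) (b c)
        then stepProgress η w ε T p (x c) (b c) else 0 := by
  have hηT : 0 < η * T := by linarith
  have hwt : ∀ c, 0 ≤ stepWeight w p (x c) := fun c => by linarith [one_le_stepWeight hw hp (hx c)]
  set q : Fin n → ℝ := fun c =>
    if 0 < stepGain w ε p (x c) (b c) then stepProgress η w ε T p (x c) (b c) else 0 with hq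
  have h1 : ∑ c, stepWeight w p (x c) ≤ 32 * (n + d) := by
    simp only [stepWeight, Finset.sum_add_distrib, ← Finset.mul_sum, Finset.sum_const,
      Finset.card_univ, Fintype.card_fin, nsmul_eq_mul, mul_one]
    have : (d : ℝ) * ∑ c, stepCost w p (x c) ≤ d * 32 := by gcongr
    linarith [Nat.cast_nonneg (α := ℝ) n]
  have h2 : 3 / 2 * ε ≤ ∑ c, stepGain w ε p (x c) (b c) := by
    have e1 : ∑ c, stepGain w ε p (x c) (b c) =
        (w * (p ⬝ᵥ ∑ c, x c) + ε / 4 * ((∑ i, (∑ c, x c) i) / d)) -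
          (w * ∑ c, p ⬝ᵥ b c + ε / 4 * ∑ c, (∑ i, b c i) / d) := by
      simp only [stepGain, dotProduct_sum, Finset.sum_apply, sub_div, mul_sub,
        Finset.sum_add_distrib, Finset.sum_sub_distrib, Finset.mul_sum, Finset.sum_div]
      rw [Finset.sum_comm]
      ring
    have e2 : ∑ c, stepPrice w ε p ⬝ᵥ b c =
        w * ∑ c, p ⬝ᵥ b c + ε / 2 * ∑ c, (∑ i, b c i) / d := by
      simp only [stepPrice_dotProduct, Finset.sum_add_distrib, Finset.mul_sum]
    have e3 : 0 ≤ ∑ c, (∑ i, b c i) / d := Finset.sum_nonneg fun c _ =>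
      div_nonneg (Finset.sum_nonneg fun i _ => hb c i) d.cast_nonneg
    nlinarith [mul_nonneg hε e3]
  have h3 : ε ^ 2 / 32 ≤ 32 * (η * T) * ∑ c, stepWeight w p (x c) * q c := by
    have e1 := Finset.sum_le_sum fun c (_ : c ∈ Finset.univ) =>
      mul_gain_sub_le (τ := ε / 32) hd hη hw hε hT hp (hx c) (hb c) (hmin c) (by linarith)
        (by linarith)
    rw [Finset.sum_sub_distrib, ← Finset.mul_sum, ← Finset.mul_sum, ← Finset.mul_sum] at e1
    have e2 : ε / 32 * (3 / 2 * ε) ≤ ε / 32 * ∑ c, stepGain w ε p (x c) (b c) := by gcongr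
    have e3 : (ε / 32) ^ 2 / 2 * ∑ c, stepCost w p (x c) ≤ (ε / 32) ^ 2 / 2 * 32 := by gcongr
    refine le_trans ?_ e1
    linarith
  have h4 : 2 * μ * ∑ c, stepWeight w p (x c) ≤ ∑ c, stepWeight w p (x c) * q c := by
    have e1 : 2 * μ * ∑ c, stepWeight w p (x c) ≤ 2 * μ * (32 * (n + d)) := by gcongr
    nlinarith
  have h5 : ∑ c, stepWeight w p (x c) * q c - μ * ∑ c, stepWeight w p (x c) ≤
      ∑ c, stepWeight w p (x c) *
        if 0 < stepGain w ε p (x c) (b c) ∧ μ ≤ stepProgress η w ε T p (x c) (b c)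
          then stepProgress η w ε T p (x c) (b c) else 0 := by
    rw [Finset.mul_sum, ← Finset.sum_sub_distrib]
    refine Finset.sum_le_sum fun c _ => ?_
    rw [mul_comm μ, ← mul_sub]
    refine mul_le_mul_of_nonneg_left ?_ (hwt c)
    simp only [hq]
    split_ifs with i1 i2 i2
    · linarith
    · have : ¬ μ ≤ stepProgress η w ε T p (x c) (b c) := fun h => i2 ⟨i1, h⟩
      linarith
    · exact absurd i2.1 i1
    · linarith
  linarith

end Step

/-! ### The levels of the search -/

section Levels

/-- The scale of a level, growing from about `1 / d` to about `1 / η`. -/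
noncomputable def levelScale (d ℓ : ℕ) : ℝ := 2 ^ ℓ / 2 ^ Nat.clog 2 d

/-- The factor by which norms are multiplied at a level. -/
noncomputable def levelFactor (d ℓ : ℕ) : ℝ := min 1 (levelScale d ℓ)

/-- The accuracy of a level. -/
noncomputable def levelError (d ℓ : ℕ) : ℝ := min 1 (levelScale d ℓ)⁻¹

/-- The factor by which loads are multiplied before the gradient is evaluated. -/
noncomputable def levelTime (n d : ℕ) (η : ℝ) (ℓ : ℕ) : ℝ :=
  4 * (Real.log (n + d) * levelScale d ℓ + 1) / η

/-- The least progress of a step that is accepted. -/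
noncomputable def levelProgress (n d : ℕ) (η : ℝ) (ℓ : ℕ) : ℝ :=
  levelError d ℓ ^ 2 / (65536 * (η * levelTime n d η ℓ) * (n + d))

/-- The decrease of the potential of the whole search that corresponds to an accepted step. -/
noncomputable def dropRate (n d : ℕ) (η : ℝ) : ℝ := η ^ 2 / (32768 * (n + d))

/-- The last level. -/
noncomputable def lastLevel (d : ℕ) (η : ℝ) : ℕ := Nat.clog 2 d + Nat.clog 2 ⌈η⁻¹⌉₊

variable {n d : ℕ} {η : ℝ}

lemma half_le_log (hn : 1 ≤ n) (hd : 1 ≤ d) : 1 / 2 ≤ Real.log ((n : ℝ) + d) := by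
  have h1 : (1 : ℝ) ≤ n := by exact_mod_cast hn
  have h2 : (1 : ℝ) ≤ d := by exact_mod_cast hd
  have h3 : Real.log 2 ≤ Real.log ((n : ℝ) + d) := Real.log_le_log two_pos (by linarith)
  linarith [Real.log_two_gt_d9]

lemma levelScale_pos (d ℓ : ℕ) : 0 < levelScale d ℓ := by
  unfold levelScale
  positivity

lemma levelFactor_pos (d ℓ : ℕ) : 0 < levelFactor d ℓ := lt_min one_pos (levelScale_pos d ℓ)

lemma levelFactor_le_one (d ℓ : ℕ) : levelFactor d ℓ ≤ 1 := min_le_left _ _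

lemma levelError_pos (d ℓ : ℕ) : 0 < levelError d ℓ :=
  lt_min one_pos (inv_pos.mpr (levelScale_pos d ℓ))

lemma levelError_le_one (d ℓ : ℕ) : levelError d ℓ ≤ 1 := min_le_left _ _

lemma level_cases (d ℓ : ℕ) :
    (levelScale d ℓ ≤ 1 ∧ levelFactor d ℓ = levelScale d ℓ ∧ levelError d ℓ = 1) ∨
    (1 ≤ levelScale d ℓ ∧ levelFactor d ℓ = 1 ∧ levelError d ℓ = (levelScale d ℓ)⁻¹) := by
  rcases le_total (levelScale d ℓ) 1 with h | h
  · exact Or.inl ⟨h, min_eq_right h, min_eq_left ((one_le_inv₀ (levelScale_pos d ℓ)).mpr h)⟩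
  · exact Or.inr ⟨h, min_eq_left h, min_eq_right (inv_le_one_of_one_le₀ h)⟩

lemma levelScale_succ (d ℓ : ℕ) : levelScale d (ℓ + 1) = 2 * levelScale d ℓ := by
  unfold levelScale
  ring

lemma level_succ_cases (d ℓ : ℕ) :
    (levelError d ℓ = 1 ∧ levelError d (ℓ + 1) = 1 ∧ levelFactor d (ℓ + 1) = 2 * levelFactor d ℓ) ∨
    (levelFactor d ℓ = 1 ∧ levelFactor d (ℓ + 1) = 1 ∧
      levelError d (ℓ + 1) = levelError d ℓ / 2) := by
  have hpos := levelScale_pos d ℓ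
  have hsucc := levelScale_succ d ℓ
  rcases lt_or_ge ℓ (Nat.clog 2 d) with h | h
  · left
    have h1 : levelScale d (ℓ + 1) ≤ 1 := by
      unfold levelScale
      rw [div_le_one (by positivity)]
      exact pow_le_pow_right₀ one_le_two h
    have h2 : levelScale d ℓ ≤ 1 := by linarith
    refine ⟨min_eq_left ((one_le_inv₀ hpos).mpr h2),
      min_eq_left ((one_le_inv₀ (levelScale_pos d _)).mpr h1), ?_⟩
    rw [levelFactor, levelFactor, min_eq_right h1, min_eq_right h2, hsucc]
  · right
    have h1 : 1 ≤ levelScale d ℓ := by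
      unfold levelScale
      rw [one_le_div (by positivity)]
      exact pow_le_pow_right₀ one_le_two h
    have h2 : 1 ≤ levelScale d (ℓ + 1) := by linarith
    refine ⟨min_eq_left h1, min_eq_left h2, ?_⟩
    rw [levelError, levelError, min_eq_right (inv_le_one_of_one_le₀ h1),
      min_eq_right (inv_le_one_of_one_le₀ h2), hsucc, mul_inv]
    ring

lemma levelScale_zero_mul_le (d : ℕ) : levelScale d 0 * d ≤ 1 := by
  unfold levelScale
  rw [pow_zero, one_div, inv_mul_le_one₀ (by positivity)]
  exact_mod_cast Nat.le_pow_clog one_lt_two d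

lemma levelFactor_zero_mul_le (d : ℕ) : levelFactor d 0 * d ≤ 1 :=
  (mul_le_mul_of_nonneg_right (min_le_right _ _) d.cast_nonneg).trans (levelScale_zero_mul_le d)

lemma levelScale_lastLevel (d : ℕ) (η : ℝ) :
    levelScale d (lastLevel d η) = 2 ^ Nat.clog 2 ⌈η⁻¹⌉₊ := by
  unfold levelScale lastLevel
  rw [pow_add]
  field_simp

lemma two_pow_clog_le {m : ℕ} (hm : 1 ≤ m) : 2 ^ Nat.clog 2 m ≤ 2 * m := by
  rcases hm.eq_or_lt with rfl | h
  · simp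
  · have h1 : 0 < Nat.clog 2 m := Nat.clog_pos one_lt_two h
    have h2 := Nat.pow_pred_clog_lt_self one_lt_two h
    obtain ⟨k, hk⟩ := Nat.exists_eq_add_of_lt h1
    rw [hk] at h2 ⊢
    simp only [zero_add, Nat.pred_succ] at h2
    rw [zero_add, pow_succ]
    omega

lemma inv_le_levelScale_lastLevel (d : ℕ) (η : ℝ) :
    η⁻¹ ≤ levelScale d (lastLevel d η) := by
  rw [levelScale_lastLevel]
  refine (Nat.le_ceil _).trans ?_
  exact_mod_cast Nat.le_pow_clog one_lt_two _

lemma levelScale_lastLevel_le (d : ℕ) (hη : 0 < η) (hη5 : η ≤ 1 / 5) :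
    levelScale d (lastLevel d η) * η ≤ 3 := by
  have hinv : (5 : ℝ) ≤ η⁻¹ := by
    rw [le_inv_comm₀ (by norm_num) hη]
    linarith
  have h1 : 1 ≤ ⌈η⁻¹⌉₊ := Nat.one_le_ceil_iff.mpr (inv_pos.mpr hη)
  have h2 : (2 : ℝ) ^ Nat.clog 2 ⌈η⁻¹⌉₊ ≤ 2 * ⌈η⁻¹⌉₊ := by exact_mod_cast two_pow_clog_le h1
  have h3 := Nat.ceil_lt_add_one (inv_nonneg.mpr hη.le)
  rw [levelScale_lastLevel]
  calc (2 : ℝ) ^ Nat.clog 2 ⌈η⁻¹⌉₊ * η ≤ (2 * (η⁻¹ + 1)) * η := by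
        gcongr
        linarith
    _ = 2 + 2 * η := by field_simp
    _ ≤ 3 := by linarith

lemma levelScale_mono (d : ℕ) : Monotone (levelScale d) := by
  intro i j hij
  unfold levelScale
  gcongr
  exact one_le_two

lemma le_levelError (hη : 0 < η) (hη5 : η ≤ 1 / 5) {ℓ : ℕ} (hℓ : ℓ ≤ lastLevel d η) :
    η / 3 ≤ levelError d ℓ := by
  refine le_min (by linarith) ?_
  rw [le_inv_comm₀ (by positivity) (levelScale_pos d ℓ), inv_div, le_div_iff₀ hη]
  exact (mul_le_mul_of_nonneg_right (levelScale_mono d hℓ) hη.le).trans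
    (levelScale_lastLevel_le d hη hη5)

lemma lastLevel_factor (hη : 0 < η) (hη5 : η ≤ 1 / 5) :
    levelFactor d (lastLevel d η) = 1 ∧ levelError d (lastLevel d η) ≤ η := by
  have h1 := inv_le_levelScale_lastLevel d η
  have h2 : 1 ≤ η⁻¹ := (one_le_inv₀ hη).mpr (by linarith)
  refine ⟨min_eq_left (h2.trans h1), (min_le_right _ _).trans ?_⟩
  exact inv_le_of_inv_le₀ hη h1

lemma mul_levelTime (hη : 0 < η) (ℓ : ℕ) :
    η * levelTime n d η ℓ = 4 * (Real.log (n + d) * levelScale d ℓ + 1) := by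
  unfold levelTime
  field_simp

lemma four_le_mul_levelTime (hn : 1 ≤ n) (hd : 1 ≤ d) (hη : 0 < η) (ℓ : ℕ) :
    4 ≤ η * levelTime n d η ℓ := by
  rw [mul_levelTime hη]
  have := mul_pos (one_half_pos.trans_le (half_le_log hn hd)) (levelScale_pos d ℓ)
  linarith

lemma levelTime_pos (hn : 1 ≤ n) (hd : 1 ≤ d) (hη : 0 < η) (ℓ : ℕ) : 0 < levelTime n d η ℓ :=
  pos_of_mul_pos_right (by linarith [four_le_mul_levelTime hn hd hη ℓ]) hη.le

lemma levelFactor_eq (d ℓ : ℕ) : levelFactor d ℓ = levelError d ℓ * levelScale d ℓ := by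
  rcases level_cases d ℓ with ⟨-, h1, h2⟩ | ⟨-, h1, h2⟩
  · rw [h1, h2, one_mul]
  · rw [h1, h2, inv_mul_cancel₀ (levelScale_pos d ℓ).ne']

lemma additive_error_le (hn : 1 ≤ n) (hd : 1 ≤ d) (hη : 0 < η) (ℓ : ℕ) :
    levelFactor d ℓ / levelTime n d η ℓ * (Real.log d / η) ≤ levelError d ℓ / 4 := by
  have h1 := levelTime_pos hn hd hη ℓ
  have h2 : Real.log d ≤ Real.log ((n : ℝ) + d) :=
    Real.log_le_log (by exact_mod_cast hd) (by linarith [Nat.cast_nonneg (α := ℝ) n])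
  have h3 := levelError_pos d ℓ
  have h4 := levelScale_pos d ℓ
  rw [div_mul_div_comm, div_le_iff₀ (by positivity), levelFactor_eq, mul_comm _ η,
    mul_levelTime hη]
  calc levelError d ℓ * levelScale d ℓ * Real.log d
      ≤ levelError d ℓ * levelScale d ℓ * Real.log (n + d) := by gcongr
    _ ≤ levelError d ℓ / 4 * (4 * (Real.log (n + d) * levelScale d ℓ + 1)) := by linarith

lemma inv_mul_levelTime_le (hn : 1 ≤ n) (hd : 1 ≤ d) (hη : 0 < η) (ℓ : ℕ) :
    1 / (32 * (η * levelTime n d η ℓ)) ≤ levelError d ℓ := by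
  have hL := half_le_log hn hd
  have hz := levelScale_pos d ℓ
  have hLz := mul_le_mul_of_nonneg_right hL hz.le
  rw [mul_levelTime hη, div_le_iff₀ (by positivity)]
  rcases level_cases d ℓ with ⟨-, -, h2⟩ | ⟨-, -, h2⟩
  · rw [h2]
    linarith
  · rw [h2, inv_mul_eq_div, one_le_div hz]
    linarith

lemma dropRate_pos (hn : 1 ≤ n) (hη : 0 < η) : 0 < dropRate n d η := by
  have : (0 : ℝ) < n := by exact_mod_cast hn
  unfold dropRate
  positivity

lemma dropRate_mul_le (hn : 1 ≤ n) (hη : 0 < η) (hη5 : η ≤ 1 / 5) :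
    dropRate n d η * n ≤ 1 := by
  have : (0 : ℝ) < n := by exact_mod_cast hn
  unfold dropRate
  rw [div_mul_eq_mul_div, div_le_one (by positivity)]
  have h1 : η ^ 2 ≤ 1 := by nlinarith
  have h2 : (0 : ℝ) ≤ d := d.cast_nonneg
  nlinarith

lemma dropRate_le_one (hn : 1 ≤ n) (hη : 0 < η) (hη5 : η ≤ 1 / 5) : dropRate n d η ≤ 1 := by
  have h1 : (1 : ℝ) ≤ n := by exact_mod_cast hn
  have h2 := dropRate_mul_le (d := d) hn hη hη5
  have h3 := dropRate_pos (d := d) hn hη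
  nlinarith

lemma levelProgress_pos (hn : 1 ≤ n) (hd : 1 ≤ d) (hη : 0 < η) (ℓ : ℕ) :
    0 < levelProgress n d η ℓ := by
  have h1 := four_le_mul_levelTime hn hd hη ℓ
  have h2 : (0 : ℝ) < n := by exact_mod_cast hn
  have h3 := levelError_pos d ℓ
  unfold levelProgress
  have : 0 < η * levelTime n d η ℓ := by linarith
  positivity

lemma levelProgress_mul (hn : 1 ≤ n) (hd : 1 ≤ d) (hη : 0 < η) (ℓ : ℕ) :
    levelProgress n d η ℓ * (65536 * (η * levelTime n d η ℓ) * (n + d)) = levelError d ℓ ^ 2 := by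
  have h1 := four_le_mul_levelTime hn hd hη ℓ
  have h2 : (0 : ℝ) < n := by exact_mod_cast hn
  have : 0 < η * levelTime n d η ℓ := by linarith
  exact div_mul_cancel₀ _ (by positivity)

lemma dropRate_div_mul_le (hn : 1 ≤ n) (hd : 1 ≤ d) (hη : 0 < η) (hη5 : η ≤ 1 / 5) {ℓ : ℕ}
    (hℓ : ℓ ≤ lastLevel d η) :
    dropRate n d η / levelProgress n d η ℓ * (1 / (32 * (η * levelTime n d η ℓ))) ≤ 1 := by
  have h1 := four_le_mul_levelTime hn hd hη ℓ
  have h2 : (0 : ℝ) < n := by exact_mod_cast hn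
  have h3 := levelProgress_pos hn hd hη ℓ
  have h4 := levelProgress_mul hn hd hη ℓ
  have h5 := le_levelError hη hη5 hℓ
  have h6 : 0 < η * levelTime n d η ℓ := by linarith
  rw [div_mul_div_comm, mul_one, div_le_one (by positivity)]
  have h7 : (η / 3) ^ 2 ≤ levelError d ℓ ^ 2 := by gcongr
  rw [dropRate, div_le_iff₀ (by positivity)]
  nlinarith

end Levels

/-! ### The search for load balancing -/

/-- States of the search: a level, and loads of the customers, relative to the guess `Γ`. -/
abbrev LoadState (n d : ℕ) : Type := ℕ × (Fin n → Fin d → ℝ)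

open Classical in
/-- The local search for the guess `Γ`. -/
noncomputable def loadScheme (n d : ℕ) (η Γ : ℝ) : SearchScheme n d (LoadState n d) where
  point s := levelTime n d η s.1 • ∑ c, s.2 c
  settle s p :=
    if levelFactor d s.1 * (p ⬝ᵥ ∑ c, s.2 c) + levelError d s.1 / 4 * ((∑ i, (∑ c, s.2 c) i) / d) ≤
        levelFactor d s.1 + 2 * levelError d s.1 then
      if s.1 = lastLevel d η then some (.inr (Γ • ∑ c, s.2 c)) else some (.inl (s.1 + 1, s.2))
    else none
  price s p := stepPrice (levelFactor d s.1) (levelError d s.1) p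
  weight s p c := stepWeight (levelFactor d s.1) p (s.2 c)
  improve s p c v :=
    if 0 < stepGain (levelFactor d s.1) (levelError d s.1) p (s.2 c) (Γ⁻¹ • v) ∧
        levelProgress n d η s.1 ≤ stepProgress η (levelFactor d s.1) (levelError d s.1)
          (levelTime n d η s.1) p (s.2 c) (Γ⁻¹ • v) then
      some (s.1, stepLoads η (levelFactor d s.1) (levelError d s.1) (levelTime n d η s.1) p s.2 c
        (Γ⁻¹ • v))
    else none
  refutes s p ans := levelFactor d s.1 + levelError d s.1 / 2 <
    ∑ c, stepPrice (levelFactor d s.1) (levelError d s.1) p ⬝ᵥ (Γ⁻¹ • ans c)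

/-- An upper bound on the total decrease of the potential at a level. -/
noncomputable def levelBudget (n d : ℕ) (η : ℝ) (ℓ : ℕ) : ℝ :=
  dropRate n d η / levelProgress n d η ℓ * (4 * levelError d ℓ) + dropRate n d η

/-- The potential of a load at a level. -/
noncomputable def levelPotential (n d : ℕ) (η : ℝ) (Ψ : (Fin d → ℝ) → ℝ) (ℓ : ℕ)
    (z : Fin d → ℝ) : ℝ :=
  loadPotential Ψ (levelFactor d ℓ) (levelError d ℓ) (levelTime n d η ℓ) z

/-- The potential of the whole search. -/
noncomputable def searchPotential (n d : ℕ) (η : ℝ) (Ψ : (Fin d → ℝ) → ℝ)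
    (s : LoadState n d) : ℝ :=
  dropRate n d η / levelProgress n d η s.1 *
      max 0 (levelPotential n d η Ψ s.1 (∑ c, s.2 c) - levelFactor d s.1 - levelError d s.1) +
    ∑ ℓ ∈ Finset.Ioc s.1 (lastLevel d η), levelBudget n d η ℓ

/-- The states that occur in the search. -/
def LoadInvariant {n d : ℕ} (η Γ : ℝ) (Ψ : (Fin d → ℝ) → ℝ) (X : Fin n → Set (Fin d → ℝ))
    (s : LoadState n d) : Prop :=
  s.1 ≤ lastLevel d η ∧ (∀ c, Γ • s.2 c ∈ X c) ∧
    levelPotential n d η Ψ s.1 (∑ c, s.2 c) ≤ levelFactor d s.1 + 5 * levelError d s.1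

/-- The outputs that are correct for the guess `Γ`. -/
def IsCorrect {n d : ℕ} (η Γ : ℝ) (β : Fin d → ℝ) (X : Fin n → Set (Fin d → ℝ)) :
    Option (Fin d → ℝ) → Prop
  | none => Γ < optValue β X
  | some s => s ∈ feasibleSet X ∧ orderedNorm β s ≤ (1 + 3 * η) * Γ

/-- The hypotheses on an instance of load balancing. -/
structure IsLoadProblem (n d : ℕ) (η Γ : ℝ) (β : Fin d → ℝ) (Ψ : (Fin d → ℝ) → ℝ)
    (X : Fin n → Set (Fin d → ℝ)) (f : Fin n → (Fin d → ℝ) → (Fin d → ℝ)) : Prop where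
  hn : 1 ≤ n
  hd : 1 ≤ d
  hη : 0 < η
  hη5 : η ≤ 1 / 5
  hΓ : 0 < Γ
  weight : IsOrderedWeight β
  approx : IsNormApproximation (Real.log d / η) η β Ψ
  inst : IsLoadInstance X
  oracle : IsLinMinOracle X f

namespace IsLoadProblem

variable {n d : ℕ} {η Γ : ℝ} {β : Fin d → ℝ} {Ψ : (Fin d → ℝ) → ℝ}
  {X : Fin n → Set (Fin d → ℝ)} {f : Fin n → (Fin d → ℝ) → (Fin d → ℝ)}

lemma stepPrice_pos (P : IsLoadProblem n d η Γ β Ψ X f) {w ε : ℝ} (hw : 0 ≤ w) (hε : 0 < ε)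
    {p : Fin d → ℝ} (hp : p ∈ nonnegOrthant d) (i : Fin d) : 0 < stepPrice w ε p i := by
  have : (0 : ℝ) < d := by exact_mod_cast P.hd
  have := mul_nonneg hw (hp i)
  unfold stepPrice
  positivity

lemma oracle_spec (P : IsLoadProblem n d η Γ β Ψ X f) {w ε : ℝ} (hw : 0 ≤ w) (hε : 0 < ε)
    {p : Fin d → ℝ} (hp : p ∈ nonnegOrthant d) (c : Fin n) :
    f c (stepPrice w ε p) ∈ X c ∧
      ∀ x ∈ X c, stepPrice w ε p ⬝ᵥ f c (stepPrice w ε p) ≤ stepPrice w ε p ⬝ᵥ x :=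
  P.oracle c _ (fun i => (P.stepPrice_pos hw hε hp i).le)
    (exists_isLeast_dotProduct (P.inst.nonempty c) (P.inst.closed c) (P.inst.subset c)
      (P.stepPrice_pos hw hε hp))

lemma mem_of_smul_mem (P : IsLoadProblem n d η Γ β Ψ X f) {c : Fin n} {x : Fin d → ℝ}
    (hx : Γ • x ∈ X c) : x ∈ nonnegOrthant d := by
  intro i
  have := P.inst.subset c hx i
  exact nonneg_of_mul_nonneg_right this P.hΓ

lemma smul_inv_smul (P : IsLoadProblem n d η Γ β Ψ X f) (x : Fin d → ℝ) : Γ • Γ⁻¹ • x = x :=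
  smul_inv_smul₀ P.hΓ.ne' x

/-- If the answers of the oracles cost too much, then the optimum is larger than the guess. -/
lemma lt_optValue (P : IsLoadProblem n d η Γ β Ψ X f) {w ε : ℝ} (hw : 0 ≤ w) (hε : 0 < ε)
    {p : Fin d → ℝ} (hp : p ∈ nonnegOrthant d)
    (hle : ∀ x ∈ nonnegOrthant d, w * (p ⬝ᵥ x) ≤ w * orderedNorm β x)
    (hlt : w + ε / 2 < ∑ c, stepPrice w ε p ⬝ᵥ (Γ⁻¹ • f c (stepPrice w ε p))) :
    Γ < optValue β X := by
  have hd : (0 : ℝ) < d := by exact_mod_cast P.hd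
  simp only [dotProduct_smul, smul_eq_mul, ← Finset.mul_sum] at hlt
  set σ := ∑ c, stepPrice w ε p ⬝ᵥ f c (stepPrice w ε p) with hσ
  have hκ : 0 < w + ε / 2 := by positivity
  rw [lt_inv_mul_iff₀ P.hΓ] at hlt
  have h1 : Γ < σ / (w + ε / 2) := by rwa [lt_div_iff₀ hκ]
  refine h1.trans_le (le_csInf ?_ ?_)
  · choose x hx using P.inst.nonempty
    exact ⟨_, ∑ c, x c, ⟨x, hx, rfl⟩, rfl⟩
  · rintro _ ⟨_, ⟨x, hx, rfl⟩, rfl⟩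
    rw [div_le_iff₀ hκ]
    have hmem : ∑ c, x c ∈ nonnegOrthant d :=
      sum_mem_nonnegOrthant fun c _ => P.inst.subset c (hx c)
    calc σ ≤ ∑ c, stepPrice w ε p ⬝ᵥ x c :=
          Finset.sum_le_sum fun c _ => (P.oracle_spec hw hε hp c).2 _ (hx c)
      _ = w * (p ⬝ᵥ ∑ c, x c) + ε / 2 * ((∑ i, (∑ c, x c) i) / d) := by
          rw [← dotProduct_sum, stepPrice_dotProduct]
      _ ≤ w * orderedNorm β (∑ c, x c) + ε / 2 * orderedNorm β (∑ c, x c) := by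
          refine add_le_add (hle _ hmem) (mul_le_mul_of_nonneg_left ?_ (by linarith))
          rw [div_le_iff₀' hd]
          exact sum_le_mul_orderedNorm P.weight _
      _ = orderedNorm β (∑ c, x c) * (w + ε / 2) := by ring

lemma scaled_norm_le (P : IsLoadProblem n d η Γ β Ψ X f) (ℓ : ℕ) {z : Fin d → ℝ}
    (hz : z ∈ nonnegOrthant d) :
    levelFactor d ℓ * orderedNorm β z + levelError d ℓ / 4 * ((∑ i, z i) / d) ≤
      levelPotential n d η Ψ ℓ z := by
  have hT := levelTime_pos P.hn P.hd P.hη ℓ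
  have h1 := orderedNorm_smul_le P.weight (inv_nonneg.mpr hT.le) (levelTime n d η ℓ • z)
  rw [inv_smul_smul₀ hT.ne'] at h1
  have h2 := P.approx.norm_le _ (smul_mem_nonnegOrthant hT.le hz)
  have h3 := mul_le_mul_of_nonneg_left
    (h1.trans (mul_le_mul_of_nonneg_left h2 (inv_nonneg.mpr hT.le))) (levelFactor_pos d ℓ).le
  unfold levelPotential loadPotential
  rw [div_eq_mul_inv (levelFactor d ℓ), mul_assoc (levelFactor d ℓ)]
  linarith

lemma levelPotential_le (P : IsLoadProblem n d η Γ β Ψ X f) (ℓ : ℕ) {z : Fin d → ℝ}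
    (hz : z ∈ nonnegOrthant d) :
    levelPotential n d η Ψ ℓ z ≤ levelFactor d ℓ * orderedNorm β z +
      levelError d ℓ / 4 * ((∑ i, z i) / d) + levelError d ℓ / 4 := by
  have hT := levelTime_pos P.hn P.hd P.hη ℓ
  have hw := levelFactor_pos d ℓ
  have h1 := orderedNorm_smul_le P.weight hT.le z
  have h2 := P.approx.le_norm_add _ (smul_mem_nonnegOrthant hT.le hz)
  have h3 := mul_le_mul_of_nonneg_left (h2.trans (add_le_add_left h1 _)) (div_pos hw hT).le
  have h4 := additive_error_le P.hn P.hd P.hη ℓ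
  have h5 : levelFactor d ℓ / levelTime n d η ℓ * (levelTime n d η ℓ * orderedNorm β z) =
      levelFactor d ℓ * orderedNorm β z := by field_simp
  unfold levelPotential loadPotential
  rw [mul_add, h5] at h3
  linarith

lemma levelPotential_sub_le (P : IsLoadProblem n d η Γ β Ψ X f) (ℓ : ℕ) {z : Fin d → ℝ}
    (hz : z ∈ nonnegOrthant d) :
    levelPotential n d η Ψ ℓ z - levelError d ℓ / 4 ≤
      levelFactor d ℓ * (orthantGradient Ψ (levelTime n d η ℓ • z) ⬝ᵥ z) +
        levelError d ℓ / 4 * ((∑ i, z i) / d) := by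
  have hT := levelTime_pos P.hn P.hd P.hη ℓ
  have h1 := P.approx.sub_le_dotProduct_self P.weight (smul_mem_nonnegOrthant hT.le hz)
  have h2 := mul_le_mul_of_nonneg_left h1 (div_pos (levelFactor_pos d ℓ) hT).le
  have h4 := additive_error_le P.hn P.hd P.hη ℓ
  rw [dotProduct_smul, smul_eq_mul, mul_sub, ← mul_assoc, div_mul_cancel₀ _ hT.ne'] at h2
  unfold levelPotential loadPotential
  linarith

lemma dotProduct_le_scaled_norm (P : IsLoadProblem n d η Γ β Ψ X f) (ℓ : ℕ) {z x : Fin d → ℝ}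
    (hz : z ∈ nonnegOrthant d) (hx : x ∈ nonnegOrthant d) :
    levelFactor d ℓ * (orthantGradient Ψ (levelTime n d η ℓ • z) ⬝ᵥ x) ≤
      levelFactor d ℓ * orderedNorm β x :=
  mul_le_mul_of_nonneg_left (P.approx.dotProduct_le_orderedNorm P.weight
    (smul_mem_nonnegOrthant (levelTime_pos P.hn P.hd P.hη ℓ).le hz) hx) (levelFactor_pos d ℓ).le

lemma gradient_mem (P : IsLoadProblem n d η Γ β Ψ X f) (ℓ : ℕ) {z : Fin d → ℝ}
    (hz : z ∈ nonnegOrthant d) :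
    orthantGradient Ψ (levelTime n d η ℓ • z) ∈ nonnegOrthant d :=
  P.approx.gradient_mem P.hη.le
    (smul_mem_nonnegOrthant (levelTime_pos P.hn P.hd P.hη ℓ).le hz)

lemma theta_pos (P : IsLoadProblem n d η Γ β Ψ X f) (ℓ : ℕ) :
    0 < dropRate n d η / levelProgress n d η ℓ :=
  div_pos (dropRate_pos P.hn P.hη) (levelProgress_pos P.hn P.hd P.hη ℓ)

lemma levelBudget_nonneg (P : IsLoadProblem n d η Γ β Ψ X f) (ℓ : ℕ) :
    0 ≤ levelBudget n d η ℓ :=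
  add_nonneg (mul_nonneg (P.theta_pos ℓ).le (by linarith [levelError_pos d ℓ]))
    (dropRate_pos P.hn P.hη).le

lemma searchPotential_le (P : IsLoadProblem n d η Γ β Ψ X f) {s : LoadState n d}
    (hs : LoadInvariant η Γ Ψ X s) :
    searchPotential n d η Ψ s + dropRate n d η ≤
      levelBudget n d η s.1 + ∑ ℓ ∈ Finset.Ioc s.1 (lastLevel d η), levelBudget n d η ℓ := by
  have h1 : max 0 (levelPotential n d η Ψ s.1 (∑ c, s.2 c) - levelFactor d s.1 - levelError d s.1) ≤
      4 * levelError d s.1 :=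
    max_le (by linarith [levelError_pos d s.1]) (by linarith [hs.2.2])
  have h2 := mul_le_mul_of_nonneg_left h1 (P.theta_pos s.1).le
  have h3 : levelBudget n d η s.1 = dropRate n d η / levelProgress n d η s.1 *
      (4 * levelError d s.1) + dropRate n d η := rfl
  rw [h3]
  unfold searchPotential
  linarith

lemma sum_mem (P : IsLoadProblem n d η Γ β Ψ X f) {s : LoadState n d}
    (hs : LoadInvariant η Γ Ψ X s) : ∑ c, s.2 c ∈ nonnegOrthant d :=
  sum_mem_nonnegOrthant fun c _ => P.mem_of_smul_mem (hs.2.1 c)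

lemma invariant_succ (P : IsLoadProblem n d η Γ β Ψ X f) {s : LoadState n d}
    (hs : LoadInvariant η Γ Ψ X s) (hlast : s.1 ≠ lastLevel d η)
    (hset : levelFactor d s.1 *
        (orthantGradient Ψ (levelTime n d η s.1 • ∑ c, s.2 c) ⬝ᵥ ∑ c, s.2 c) +
      levelError d s.1 / 4 * ((∑ i, (∑ c, s.2 c) i) / d) ≤
        levelFactor d s.1 + 2 * levelError d s.1) :
    LoadInvariant η Γ Ψ X (s.1 + 1, s.2) := by
  have hz := P.sum_mem hs
  refine ⟨lt_of_le_of_ne hs.1 hlast, hs.2.1, ?_⟩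
  have h1 := P.levelPotential_sub_le s.1 hz
  have h2 := P.scaled_norm_le s.1 hz
  have h3 := P.levelPotential_le (s.1 + 1) hz
  have hN := orderedNorm_nonneg P.weight (∑ c, s.2 c)
  have hQ : 0 ≤ (∑ i, (∑ c, s.2 c) i) / d :=
    div_nonneg (Finset.sum_nonneg fun i _ => hz i) d.cast_nonneg
  have hw := levelFactor_pos d s.1
  have hE := levelError_pos d s.1
  simp only
  rcases level_succ_cases d s.1 with ⟨e1, e2, e3⟩ | ⟨e1, e2, e3⟩
  · rw [e1] at h1 h2 hset
    rw [e2, e3] at h3 ⊢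
    nlinarith
  · rw [e1] at h1 h2 hset
    rw [e2, e3] at h3 ⊢
    nlinarith [mul_nonneg hE.le hQ]

lemma sum_stepCost_le (P : IsLoadProblem n d η Γ β Ψ X f) {s : LoadState n d}
    (hs : LoadInvariant η Γ Ψ X s) :
    ∑ c, stepCost (levelFactor d s.1) (orthantGradient Ψ (levelTime n d η s.1 • ∑ c, s.2 c))
      (s.2 c) ≤ 32 := by
  have hz := P.sum_mem hs
  have hd : (0 : ℝ) < d := by exact_mod_cast P.hd
  set z := ∑ c, s.2 c with hzdef
  have h0 : ∑ c, stepCost (levelFactor d s.1) (orthantGradient Ψ (levelTime n d η s.1 • z)) (s.2 c) =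
      levelFactor d s.1 * (orthantGradient Ψ (levelTime n d η s.1 • z) ⬝ᵥ z) + (∑ i, z i) / d := by
    simp only [stepCost, Finset.sum_add_distrib, hzdef, dotProduct_sum, Finset.mul_sum,
      Finset.sum_div, Finset.sum_apply]
    rw [Finset.sum_comm]
  have h1 := P.dotProduct_le_scaled_norm s.1 hz hz
  have h2 := P.scaled_norm_le s.1 hz
  have h3 := hs.2.2
  have h4 : (∑ i, z i) / d ≤ orderedNorm β z := by
    rw [div_le_iff₀' hd]
    exact sum_le_mul_orderedNorm P.weight _
  have hQ : 0 ≤ (∑ i, z i) / d := div_nonneg (Finset.sum_nonneg fun i _ => hz i) d.cast_nonneg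
  have hw := levelFactor_le_one d s.1
  have hE := levelError_le_one d s.1
  have hN := mul_nonneg (levelFactor_pos d s.1).le (orderedNorm_nonneg P.weight z)
  have hEQ := mul_nonneg (levelError_pos d s.1).le hQ
  rw [h0]
  rcases level_cases d s.1 with ⟨-, -, e⟩ | ⟨-, e, -⟩
  · rw [e] at h2 h3
    linarith
  · rw [e] at h1 h2 h3 ⊢
    linarith

lemma smul_stepLoads_mem (P : IsLoadProblem n d η Γ β Ψ X f) {s : LoadState n d}
    (hs : LoadInvariant η Γ Ψ X s) {p v : Fin d → ℝ} (hp : p ∈ nonnegOrthant d) {c : Fin n}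
    (hv : v ∈ X c)
    (hgain : 0 < stepGain (levelFactor d s.1) (levelError d s.1) p (s.2 c) (Γ⁻¹ • v)) (c' : Fin n) :
    Γ • stepLoads η (levelFactor d s.1) (levelError d s.1) (levelTime n d η s.1) p s.2 c
      (Γ⁻¹ • v) c' ∈ X c' := by
  unfold stepLoads
  by_cases hc : c' = c
  · subst hc
    rw [Function.update_self]
    have hb : Γ • Γ⁻¹ • v ∈ X c' := by rwa [P.smul_inv_smul]
    obtain ⟨h0, h1⟩ := stepLength_bounds P.hη (levelFactor_pos d s.1).le (levelError_pos d s.1).le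
      (levelError_le_one d s.1) (four_le_mul_levelTime P.hn P.hd P.hη s.1) hp
      (P.mem_of_smul_mem (hs.2.1 c')) (P.mem_of_smul_mem hb) hgain
    rw [smul_add, smul_comm Γ, smul_comm Γ]
    exact P.inst.convex c' (hs.2.1 c') hb (by linarith) h0 (by ring)
  · rw [Function.update_of_ne hc]
    exact hs.2.1 c'

/-- The drop of the potential in an accepted step. -/
lemma step_spec (P : IsLoadProblem n d η Γ β Ψ X f) {s : LoadState n d}
    (hs : LoadInvariant η Γ Ψ X s) {p : Fin d → ℝ}
    (hp : p = orthantGradient Ψ (levelTime n d η s.1 • ∑ c, s.2 c))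
    (hset : ¬ levelFactor d s.1 * (p ⬝ᵥ ∑ c, s.2 c) +
      levelError d s.1 / 4 * ((∑ i, (∑ c, s.2 c) i) / d) ≤
        levelFactor d s.1 + 2 * levelError d s.1) (c : Fin n) {b : Fin d → ℝ}
    (hb : b = Γ⁻¹ • f c (stepPrice (levelFactor d s.1) (levelError d s.1) p))
    (hgain : 0 < stepGain (levelFactor d s.1) (levelError d s.1) p (s.2 c) b) :
    LoadInvariant η Γ Ψ X (s.1, stepLoads η (levelFactor d s.1) (levelError d s.1)
      (levelTime n d η s.1) p s.2 c b) ∧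
    searchPotential n d η Ψ (s.1, stepLoads η (levelFactor d s.1) (levelError d s.1)
      (levelTime n d η s.1) p s.2 c b) +
      dropRate n d η / levelProgress n d η s.1 * stepProgress η (levelFactor d s.1)
        (levelError d s.1) (levelTime n d η s.1) p (s.2 c) b ≤ searchPotential n d η Ψ s := by
  have hz := P.sum_mem hs
  have hw := levelFactor_pos d s.1
  have hE := levelError_pos d s.1
  have hT := four_le_mul_levelTime P.hn P.hd P.hη s.1
  have hpm : p ∈ nonnegOrthant d := hp ▸ P.gradient_mem s.1 hz
  obtain ⟨hv, hmin⟩ := P.oracle_spec hw.le hE hpm c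
  have hxm := fun c => P.mem_of_smul_mem (hs.2.1 c)
  have hbX : Γ • b ∈ X c := by rwa [hb, P.smul_inv_smul]
  have hbm := P.mem_of_smul_mem hbX
  have hmin' : stepPrice (levelFactor d s.1) (levelError d s.1) p ⬝ᵥ b ≤
      stepPrice (levelFactor d s.1) (levelError d s.1) p ⬝ᵥ s.2 c := by
    have := mul_le_mul_of_nonneg_left (hmin _ (hs.2.1 c)) (inv_nonneg.mpr P.hΓ.le)
    rw [dotProduct_smul, smul_eq_mul, inv_mul_cancel_left₀ P.hΓ.ne'] at this
    rwa [hb, dotProduct_smul, smul_eq_mul]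
  have hstep := loadPotential_step_le P.approx P.hd P.hη hw.le hE.le (levelError_le_one d s.1) hT
    hxm hp c hbm hmin' hgain
  have hprog := (stepProgress_le P.hd hw.le hE.le (levelError_le_one d s.1) hT hpm (hxm c) hbm
    hgain).trans (inv_mul_levelTime_le P.hn P.hd P.hη s.1)
  have hprog0 : 0 ≤ stepProgress η (levelFactor d s.1) (levelError d s.1) (levelTime n d η s.1)
      p (s.2 c) b := by
    unfold stepProgress
    have h1 := stepCost_nonneg hw.le hpm (hxm c)
    have h2 := stepWidth_pos (b := b) hw.le hpm (hxm c)
    have h3 : 0 < η * levelTime n d η s.1 := by linarith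
    positivity
  have hbig := P.levelPotential_sub_le s.1 hz
  have hdot := P.dotProduct_le_scaled_norm s.1 hz hz
  have hnorm := P.scaled_norm_le s.1 hz
  rw [← hp] at hbig hdot
  push Not at hset
  set pr := stepProgress η (levelFactor d s.1) (levelError d s.1) (levelTime n d η s.1)
    p (s.2 c) b
  set x' := stepLoads η (levelFactor d s.1) (levelError d s.1) (levelTime n d η s.1) p s.2 c b
    with hx'
  have hstep' : levelPotential n d η Ψ s.1 (∑ c', x' c') ≤
      levelPotential n d η Ψ s.1 (∑ c', s.2 c') - pr := hstep
  refine ⟨⟨hs.1, fun c' => ?_, ?_⟩, ?_⟩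
  · simp only
    rw [hx', hb]
    exact P.smul_stepLoads_mem hs hpm hv (hb ▸ hgain) c'
  · simp only
    linarith [hs.2.2]
  · unfold searchPotential
    simp only
    have hmax : max 0 (levelPotential n d η Ψ s.1 (∑ c', x' c') - levelFactor d s.1 -
        levelError d s.1) + pr ≤ max 0 (levelPotential n d η Ψ s.1 (∑ c', s.2 c') -
        levelFactor d s.1 - levelError d s.1) := by
      refine le_trans ?_ (le_max_right _ _)
      rw [max_add]
      exact max_le (by linarith) (by linarith)
    have := mul_le_mul_of_nonneg_left hmax (P.theta_pos s.1).le
    rw [mul_add] at this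
    linarith

lemma settle_eq_none {s : LoadState n d} {p : Fin d → ℝ}
    (h : (loadScheme n d η Γ).settle s p = none) :
    ¬ levelFactor d s.1 * (p ⬝ᵥ ∑ c, s.2 c) +
      levelError d s.1 / 4 * ((∑ i, (∑ c, s.2 c) i) / d) ≤
        levelFactor d s.1 + 2 * levelError d s.1 := by
  intro hle
  simp only [loadScheme, if_pos hle] at h
  split_ifs at h

theorem isPotential (P : IsLoadProblem n d η Γ β Ψ X f) :
    (loadScheme n d η Γ).IsPotential (orthantGradient Ψ) f (IsCorrect η Γ β X)
      (LoadInvariant η Γ Ψ X) (searchPotential n d η Ψ) (dropRate n d η) where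
  nonneg s _ := add_nonneg (mul_nonneg (P.theta_pos s.1).le (le_max_left _ _))
    (Finset.sum_nonneg fun ℓ _ => P.levelBudget_nonneg ℓ)
  settle_state s s' hs h := by
    simp only [loadScheme] at h
    split_ifs at h with h1 h2
    · simp at h
    · simp only [Option.some.injEq, Sum.inl.injEq] at h
      subst h
      have hinv := P.invariant_succ hs h2 h1
      refine ⟨hinv, (P.searchPotential_le hinv).trans ?_⟩
      simp only
      have hlt : s.1 < lastLevel d η := lt_of_le_of_ne hs.1 h2
      have hsplit : ∑ ℓ ∈ Finset.Ioc s.1 (lastLevel d η), levelBudget n d η ℓ =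
          levelBudget n d η (s.1 + 1) +
            ∑ ℓ ∈ Finset.Ioc (s.1 + 1) (lastLevel d η), levelBudget n d η ℓ := by
        rw [← Finset.sum_insert (by simp)]
        congr 1
        ext ℓ
        simp only [Finset.mem_insert, Finset.mem_Ioc]
        omega
      rw [← hsplit]
      unfold searchPotential
      exact le_add_of_nonneg_left (mul_nonneg (P.theta_pos s.1).le (le_max_left _ _))
  settle_out s x hs h := by
    simp only [loadScheme] at h
    split_ifs at h with h1 h2
    · simp only [Option.some.injEq, Sum.inr.injEq] at h
      subst h
      have hz := P.sum_mem hs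
      have e1 := P.levelPotential_sub_le s.1 hz
      have e2 := P.scaled_norm_le s.1 hz
      have hQ : 0 ≤ (∑ i, (∑ c, s.2 c) i) / d :=
        div_nonneg (Finset.sum_nonneg fun i _ => hz i) d.cast_nonneg
      have hEQ := mul_nonneg (levelError_pos d s.1).le hQ
      obtain ⟨e3, e4⟩ := lastLevel_factor (d := d) P.hη P.hη5
      rw [← h2] at e3 e4
      rw [e3] at e1 e2 h1
      refine ⟨⟨fun c => Γ • s.2 c, hs.2.1, Finset.smul_sum⟩,
        (orderedNorm_smul_le P.weight P.hΓ.le _).trans ?_⟩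
      rw [mul_comm]
      refine mul_le_mul_of_nonneg_right ?_ P.hΓ.le
      linarith [P.hη]
    · simp at h
  improve s s' c hs hset h := by
    have hset' := settle_eq_none hset
    simp only [loadScheme] at h hset'
    split_ifs at h with h1
    simp only [Option.some.injEq] at h
    subst h
    obtain ⟨i1, i2⟩ := P.step_spec hs rfl hset' c rfl h1.1
    refine ⟨i1, le_trans (add_le_add_right ?_ _) i2⟩
    have hμ := levelProgress_pos P.hn P.hd P.hη s.1
    calc dropRate n d η = dropRate n d η / levelProgress n d η s.1 * levelProgress n d η s.1 :=
          (div_mul_cancel₀ _ hμ.ne').symm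
      _ ≤ _ := mul_le_mul_of_nonneg_left h1.2 (P.theta_pos s.1).le
  refutes s hs _ h :=
    P.lt_optValue (levelFactor_pos d s.1).le (levelError_pos d s.1)
      (P.gradient_mem s.1 (P.sum_mem hs))
      (fun _ hx => P.dotProduct_le_scaled_norm s.1 (P.sum_mem hs) hx) h
  one_le_weight s hs _ c :=
    one_le_stepWeight (levelFactor_pos d s.1).le (P.gradient_mem s.1 (P.sum_mem hs))
      (P.mem_of_smul_mem (hs.2.1 c))
  decrease s hs hset href := by
    have hset' := settle_eq_none hset
    have hz := P.sum_mem hs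
    have hw := levelFactor_pos d s.1
    have hE := levelError_pos d s.1
    have hT := four_le_mul_levelTime P.hn P.hd P.hη s.1
    set p := orthantGradient Ψ ((loadScheme n d η Γ).point s) with hp
    have hpm : p ∈ nonnegOrthant d := P.gradient_mem s.1 hz
    have hxm := fun c => P.mem_of_smul_mem (hs.2.1 c)
    set b : Fin n → Fin d → ℝ := fun c =>
      Γ⁻¹ • f c (stepPrice (levelFactor d s.1) (levelError d s.1) p) with hb
    have hbm : ∀ c, b c ∈ nonnegOrthant d := fun c => P.mem_of_smul_mem (c := c) (by
      rw [hb, P.smul_inv_smul]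
      exact (P.oracle_spec hw.le hE hpm c).1)
    have hmin : ∀ c, stepPrice (levelFactor d s.1) (levelError d s.1) p ⬝ᵥ b c ≤
        stepPrice (levelFactor d s.1) (levelError d s.1) p ⬝ᵥ s.2 c := by
      intro c
      have := mul_le_mul_of_nonneg_left ((P.oracle_spec hw.le hE hpm c).2 _ (hs.2.1 c))
        (inv_nonneg.mpr P.hΓ.le)
      rw [dotProduct_smul, smul_eq_mul, inv_mul_cancel_left₀ P.hΓ.ne'] at this
      rwa [hb, dotProduct_smul, smul_eq_mul]
    have hex := expected_progress P.hd P.hη hw.le hE.le hT hpm hxm hbm hmin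
      (le_of_not_gt href) (le_of_not_ge hset') (P.sum_stepCost_le hs)
      (levelProgress_pos P.hn P.hd P.hη s.1).le (levelProgress_mul P.hn P.hd P.hη s.1).le
    set θ := dropRate n d η / levelProgress n d η s.1 with hθ
    have hθμ : θ * levelProgress n d η s.1 = dropRate n d η :=
      div_mul_cancel₀ _ (levelProgress_pos P.hn P.hd P.hη s.1).ne'
    have hθ0 : 0 < θ := P.theta_pos s.1
    have hwt : ∀ c, 0 ≤ stepWeight (levelFactor d s.1) p (s.2 c) := fun c =>
      zero_le_one.trans (one_le_stepWeight hw.le hpm (hxm c))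
    have hfac : ∀ c, (loadScheme n d η Γ).factor f (searchPotential n d η Ψ) s p c ≤ 1 - θ / 2 *
        if 0 < stepGain (levelFactor d s.1) (levelError d s.1) p (s.2 c) (b c) ∧
          levelProgress n d η s.1 ≤ stepProgress η (levelFactor d s.1) (levelError d s.1)
            (levelTime n d η s.1) p (s.2 c) (b c)
        then stepProgress η (levelFactor d s.1) (levelError d s.1) (levelTime n d η s.1) p (s.2 c)
          (b c) else 0 := by
      intro c
      unfold SearchScheme.factor
      split
      · next s' hs' =>
        simp only [loadScheme] at hs'
        split_ifs at hs' with h1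
        simp only [Option.some.injEq] at hs'
        subst hs'
        rw [if_pos h1]
        obtain ⟨-, i2⟩ := P.step_spec hs hp hset' c (b := b c) rfl h1.1
        have hpr := stepProgress_le P.hd hw.le hE.le (levelError_le_one d s.1) hT hpm (hxm c)
          (hbm c) h1.1
        set pr := stepProgress η (levelFactor d s.1) (levelError d s.1) (levelTime n d η s.1)
          p (s.2 c) (b c)
        have hpr0 : 0 ≤ θ * pr :=
          mul_nonneg hθ0.le ((levelProgress_pos P.hn P.hd P.hη s.1).le.trans h1.2)
        have hpr1 : θ * pr ≤ 1 := (mul_le_mul_of_nonneg_left hpr hθ0.le).trans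
          (dropRate_div_mul_le P.hn P.hd P.hη P.hη5 hs.1)
        have := SearchScheme.exp_neg_le_one_sub_half hpr0 hpr1
        refine le_trans (Real.exp_le_exp.mpr ?_) (this.trans (by linarith))
        linarith
      · next hs' =>
        simp only [loadScheme] at hs'
        split_ifs at hs' with h1
        rw [if_neg h1]
        linarith
    calc ∑ c, stepWeight (levelFactor d s.1) p (s.2 c) *
          (loadScheme n d η Γ).factor f (searchPotential n d η Ψ) s p c
        ≤ ∑ c, stepWeight (levelFactor d s.1) p (s.2 c) * (1 - θ / 2 *
          if 0 < stepGain (levelFactor d s.1) (levelError d s.1) p (s.2 c) (b c) ∧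
            levelProgress n d η s.1 ≤ stepProgress η (levelFactor d s.1) (levelError d s.1)
              (levelTime n d η s.1) p (s.2 c) (b c)
          then stepProgress η (levelFactor d s.1) (levelError d s.1) (levelTime n d η s.1) p
            (s.2 c) (b c) else 0) :=
          Finset.sum_le_sum fun c _ => mul_le_mul_of_nonneg_left (hfac c) (hwt c)
      _ = ∑ c, stepWeight (levelFactor d s.1) p (s.2 c) - θ / 2 *
          ∑ c, stepWeight (levelFactor d s.1) p (s.2 c) *
          if 0 < stepGain (levelFactor d s.1) (levelError d s.1) p (s.2 c) (b c) ∧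
            levelProgress n d η s.1 ≤ stepProgress η (levelFactor d s.1) (levelError d s.1)
              (levelTime n d η s.1) p (s.2 c) (b c)
          then stepProgress η (levelFactor d s.1) (levelError d s.1) (levelTime n d η s.1) p
            (s.2 c) (b c) else 0 := by
          rw [Finset.mul_sum, ← Finset.sum_sub_distrib]
          exact Finset.sum_congr rfl fun c _ => by ring
      _ ≤ ∑ c, stepWeight (levelFactor d s.1) p (s.2 c) - θ / 2 *
          (levelProgress n d η s.1 * ∑ c, stepWeight (levelFactor d s.1) p (s.2 c)) := by
          have := mul_le_mul_of_nonneg_left hex (half_pos hθ0).le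
          linarith
      _ = (1 - dropRate n d η / 2) * ∑ c, stepWeight (levelFactor d s.1) p (s.2 c) := by
          rw [← hθμ]
          ring

end IsLoadProblem

section Budget

variable {n d : ℕ} {η : ℝ}

lemma inv_levelError_le (d ℓ : ℕ) : (levelError d ℓ)⁻¹ ≤ 1 + levelScale d ℓ := by
  have hz := levelScale_pos d ℓ
  rcases level_cases d ℓ with ⟨-, -, h⟩ | ⟨-, -, h⟩
  · rw [h, inv_one]
    linarith
  · rw [h, inv_inv]
    linarith

lemma levelBudget_le (hn : 1 ≤ n) (hd : 1 ≤ d) (hη : 0 < η) (ℓ : ℕ) :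
    levelBudget n d η ℓ ≤ dropRate n d η * (2 ^ 20 * (n + d) *
      ((Real.log (n + d) * levelScale d ℓ + 1) * (1 + levelScale d ℓ)) + 1) := by
  have hE := levelError_pos d ℓ
  have hz := levelScale_pos d ℓ
  have hL := half_le_log hn hd
  have hh := dropRate_pos (d := d) hn hη
  have hn' : (0 : ℝ) < n := by exact_mod_cast hn
  have h1 : dropRate n d η / levelProgress n d η ℓ * (4 * levelError d ℓ) =
      dropRate n d η * (2 ^ 20 * (n + d) *
        ((Real.log (n + d) * levelScale d ℓ + 1) * (levelError d ℓ)⁻¹)) := by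
    have : 0 < Real.log ((n : ℝ) + d) * levelScale d ℓ + 1 := by positivity
    rw [levelProgress, mul_levelTime hη]
    field_simp
    norm_num
  rw [levelBudget, h1, mul_add (dropRate n d η), mul_one]
  gcongr
  exact inv_levelError_le d ℓ

lemma sum_levelScale_le (d N : ℕ) :
    ∑ ℓ ∈ Finset.range (N + 1), levelScale d ℓ ≤ 2 * levelScale d N := by
  induction N with
  | zero =>
    rw [Finset.sum_range_one]
    linarith [levelScale_pos d 0]
  | succ N ih =>
    rw [Finset.sum_range_succ, levelScale_succ]
    linarith

lemma sum_levelScale_sq_le (d N : ℕ) :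
    ∑ ℓ ∈ Finset.range (N + 1), levelScale d ℓ ^ 2 ≤ 2 * levelScale d N ^ 2 := by
  have hN := levelScale_pos d N
  calc ∑ ℓ ∈ Finset.range (N + 1), levelScale d ℓ ^ 2
      ≤ ∑ ℓ ∈ Finset.range (N + 1), levelScale d ℓ * levelScale d N := by
        refine Finset.sum_le_sum fun ℓ hℓ => ?_
        rw [sq]
        exact mul_le_mul_of_nonneg_left
          (levelScale_mono d (Nat.lt_succ_iff.mp (Finset.mem_range.mp hℓ))) (levelScale_pos d ℓ).le
    _ ≤ 2 * levelScale d N ^ 2 := by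
        rw [← Finset.sum_mul, sq, ← mul_assoc]
        exact mul_le_mul_of_nonneg_right (sum_levelScale_le d N) hN.le

lemma clog_le_log (hn : 1 ≤ n) (hd : 1 ≤ d) : (Nat.clog 2 d : ℝ) ≤ 4 * Real.log (n + d) := by
  have h1 : (1 : ℝ) ≤ n := by exact_mod_cast hn
  have h2 : (1 : ℝ) ≤ d := by exact_mod_cast hd
  have h3 : (2 : ℝ) ^ Nat.clog 2 d ≤ 2 * d := by exact_mod_cast two_pow_clog_le hd
  have h4 : (2 : ℝ) ^ Nat.clog 2 d ≤ (n + d) ^ 2 := h3.trans (by nlinarith)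
  have h5 := Real.log_le_log (by positivity) h4
  rw [Real.log_pow, Real.log_pow] at h5
  push_cast at h5
  nlinarith [Real.log_two_gt_d9, (Nat.cast_nonneg (Nat.clog 2 d) : (0 : ℝ) ≤ _)]

lemma lastLevel_add_one_le (hn : 1 ≤ n) (hd : 1 ≤ d) (hη : 0 < η) (hη5 : η ≤ 1 / 5) :
    (lastLevel d η : ℝ) + 1 ≤ 4 * Real.log (n + d) + 3 / η := by
  have h1 := levelScale_lastLevel_le d hη hη5
  rw [levelScale_lastLevel, ← le_div_iff₀ hη] at h1
  have h2 : ((Nat.clog 2 ⌈η⁻¹⌉₊ : ℝ)) + 1 ≤ 2 ^ Nat.clog 2 ⌈η⁻¹⌉₊ := by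
    exact_mod_cast Nat.lt_two_pow_self
  have h3 := clog_le_log hn hd
  unfold lastLevel
  push_cast
  linarith

lemma sum_levelBudget_le (hn : 1 ≤ n) (hd : 1 ≤ d) (hη : 0 < η) (hη5 : η ≤ 1 / 5) :
    ∑ ℓ ∈ Finset.range (lastLevel d η + 1), levelBudget n d η ℓ ≤ 2048 * Real.log (n + d) := by
  have hL := half_le_log hn hd
  have hh := dropRate_pos (d := d) hn hη
  have hn' : (1 : ℝ) ≤ n := by exact_mod_cast hn
  have hd' : (1 : ℝ) ≤ d := by exact_mod_cast hd
  set L := Real.log ((n : ℝ) + d) with hLdef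
  set N := lastLevel d η with hN
  set Z := levelScale d N with hZ
  have hZ0 : 0 < Z := levelScale_pos d N
  have hZη : Z ≤ 3 / η := by
    rw [le_div_iff₀ hη]
    exact levelScale_lastLevel_le d hη hη5
  have hNle := lastLevel_add_one_le hn hd hη hη5
  have h1 := sum_levelScale_le d N
  have h2 := sum_levelScale_sq_le d N
  have hr5 : 5 ≤ 1 / η := by
    rw [le_div_iff₀ hη]
    linarith
  set r := 1 / η with hr
  have h3r : 3 / η = 3 * r := by rw [hr]; ring
  rw [h3r] at hZη hNle
  have h3 : ∑ ℓ ∈ Finset.range (N + 1), ((L * levelScale d ℓ + 1) * (1 + levelScale d ℓ)) ≤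
      36 * (L * r ^ 2) := by
    calc ∑ ℓ ∈ Finset.range (N + 1), ((L * levelScale d ℓ + 1) * (1 + levelScale d ℓ))
        = (L + 1) * ∑ ℓ ∈ Finset.range (N + 1), levelScale d ℓ +
            L * ∑ ℓ ∈ Finset.range (N + 1), levelScale d ℓ ^ 2 + (N + 1) := by
          rw [Finset.mul_sum, Finset.mul_sum, ← Finset.sum_add_distrib]
          have : ((N : ℝ) + 1) = ∑ ℓ ∈ Finset.range (N + 1), (1 : ℝ) := by simp
          rw [this, ← Finset.sum_add_distrib]
          exact Finset.sum_congr rfl fun ℓ _ => by ring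
      _ ≤ (L + 1) * (2 * (3 * r)) + L * (2 * (3 * r) ^ 2) + (4 * L + 3 * r) := by
          gcongr
          · linarith
          · refine h2.trans ?_
            gcongr
      _ ≤ 36 * (L * r ^ 2) := by
          have e1 : 5 * (L * r) ≤ L * r ^ 2 := by nlinarith [mul_pos (one_half_pos.trans_le hL) (by linarith : 0 < r)]
          have e2 : r ≤ 2 * (L * r) := by nlinarith
          have e3 : 5 * L ≤ L * r := by nlinarith
          nlinarith
  have h4 : (N : ℝ) + 1 ≤ (n + d) * (L * r ^ 2) := by
    have e1 : 5 * (L * r) ≤ L * r ^ 2 := by nlinarith [mul_pos (one_half_pos.trans_le hL) (by linarith : 0 < r)]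
    have e2 : r ≤ 2 * (L * r) := by nlinarith
    have e3 : 5 * L ≤ L * r := by nlinarith
    nlinarith
  have hM : dropRate n d η * ((n + d) * (L * r ^ 2)) = L / 32768 := by
    rw [dropRate, hr]
    field_simp
  calc ∑ ℓ ∈ Finset.range (N + 1), levelBudget n d η ℓ
      ≤ ∑ ℓ ∈ Finset.range (N + 1), dropRate n d η * (2 ^ 20 * (n + d) *
          ((L * levelScale d ℓ + 1) * (1 + levelScale d ℓ)) + 1) :=
        Finset.sum_le_sum fun ℓ _ => levelBudget_le hn hd hη ℓ
    _ = dropRate n d η * (2 ^ 20 * (n + d) * ∑ ℓ ∈ Finset.range (N + 1),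
          ((L * levelScale d ℓ + 1) * (1 + levelScale d ℓ)) + (N + 1)) := by
        rw [← Finset.mul_sum, Finset.sum_add_distrib, Finset.mul_sum]
        simp
    _ ≤ dropRate n d η * (2 ^ 20 * (n + d) * (36 * (L * r ^ 2)) + (n + d) * (L * r ^ 2)) := by
        gcongr
    _ = (2 ^ 20 * 36 + 1) * (dropRate n d η * ((n + d) * (L * r ^ 2))) := by ring
    _ ≤ 2048 * L := by
        rw [hM]
        linarith

end Budget

/-! ### The algorithm -/

/-- The unit of the bounds on the numbers of calls. -/
noncomputable def callUnit (n d : ℕ) (η : ℝ) : ℝ :=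
  ((n : ℝ) + d) / η ^ 2 * Real.log ((n : ℝ) + d)

/-- The number of gradient evaluations of the search. -/
noncomputable def gradientBudget (n d : ℕ) (η : ℝ) : ℕ := ⌈2 ^ 26 * callUnit n d η⌉₊ + 1

/-- The number of oracle calls after which the search becomes deterministic. -/
noncomputable def callBudget (n d : ℕ) (η : ℝ) : ℕ := ⌈2 ^ 30 * callUnit n d η⌉₊

open Classical in
/-- The load balancing algorithm for `n` customers and `d` resources with accuracy `η` and
guess `Γ`. -/
noncomputable def loadAlg (n d : ℕ) (η Γ : ℝ) : OracleAlg n d :=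
  if h : n = 0 then .halt none
  else
    have : NeZero n := ⟨h⟩
    .askAll (stepPrice 0 2 0) fun ans =>
      if 1 < ∑ c, stepPrice 0 2 0 ⬝ᵥ (Γ⁻¹ • ans c) then .halt none
      else (loadScheme n d η Γ).search (gradientBudget n d η) (callBudget n d η)
        (0, fun c => Γ⁻¹ • ans c)

namespace IsLoadProblem

variable {n d : ℕ} {η Γ : ℝ} {β : Fin d → ℝ} {Ψ : (Fin d → ℝ) → ℝ}
  {X : Fin n → Set (Fin d → ℝ)} {f : Fin n → (Fin d → ℝ) → (Fin d → ℝ)}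

lemma lt_optValue_of_initial (P : IsLoadProblem n d η Γ β Ψ X f)
    (h : 1 < ∑ c, stepPrice 0 2 0 ⬝ᵥ (Γ⁻¹ • f c (stepPrice 0 2 0))) : Γ < optValue β X := by
  refine P.lt_optValue le_rfl two_pos zero_mem_nonnegOrthant (fun x _ => ?_) (by rw [zero_add, div_self two_ne_zero]; exact h)
  rw [zero_mul, zero_mul]

lemma invariant_initial (P : IsLoadProblem n d η Γ β Ψ X f)
    (h : ¬ 1 < ∑ c, stepPrice 0 2 0 ⬝ᵥ (Γ⁻¹ • f c (stepPrice 0 2 0))) :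
    LoadInvariant η Γ Ψ X ((0, fun c => Γ⁻¹ • f c (stepPrice 0 2 0)) : LoadState n d) := by
  have hd : (0 : ℝ) < d := by exact_mod_cast P.hd
  have hmem : ∀ c, Γ • Γ⁻¹ • f c (stepPrice 0 2 0) ∈ X c := fun c => by
    rw [P.smul_inv_smul]
    exact (P.oracle_spec le_rfl two_pos zero_mem_nonnegOrthant c).1
  refine ⟨Nat.zero_le _, hmem, ?_⟩
  simp only
  set z := ∑ c, Γ⁻¹ • f c (stepPrice 0 2 0) with hz
  have hzm : z ∈ nonnegOrthant d := sum_mem_nonnegOrthant fun c _ => P.mem_of_smul_mem (hmem c)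
  rw [← dotProduct_sum, ← hz, stepPrice_dotProduct] at h
  have hQ : (∑ i, z i) / d ≤ 1 := by linarith
  have hQ' : ∑ i, z i ≤ d := by rwa [div_le_one hd] at hQ
  have h1 := P.levelPotential_le 0 hzm
  have hw := levelFactor_pos d 0
  have hE := levelError_pos d 0
  have h2 : levelFactor d 0 * orderedNorm β z ≤ 1 := by
    calc levelFactor d 0 * orderedNorm β z ≤ levelFactor d 0 * d :=
          mul_le_mul_of_nonneg_left ((orderedNorm_le_sum P.weight hzm).trans hQ') hw.le
      _ ≤ 1 := levelFactor_zero_mul_le d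
  have h3 : levelError d 0 = 1 := by
    refine min_eq_left ((one_le_inv₀ (levelScale_pos d 0)).mpr ?_)
    have := levelScale_zero_mul_le d
    have hd1 : (1 : ℝ) ≤ d := by exact_mod_cast P.hd
    nlinarith [levelScale_pos d 0]
  rw [h3] at h1 ⊢
  linarith

lemma searchPotential_initial_le (P : IsLoadProblem n d η Γ β Ψ X f)
    {x : Fin n → Fin d → ℝ} (hx : LoadInvariant η Γ Ψ X (0, x)) :
    searchPotential n d η Ψ (0, x) ≤ 2048 * Real.log (n + d) := by
  have h1 := P.searchPotential_le hx
  have h2 := sum_levelBudget_le P.hn P.hd P.hη P.hη5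
  have h3 : Finset.range (lastLevel d η + 1) = insert 0 (Finset.Ioc 0 (lastLevel d η)) := by
    ext ℓ
    simp only [Finset.mem_range, Finset.mem_insert, Finset.mem_Ioc]
    omega
  rw [h3, Finset.sum_insert (by simp)] at h2
  linarith [dropRate_pos (d := d) P.hn P.hη]

lemma dropRate_mul_callUnit (P : IsLoadProblem n d η Γ β Ψ X f) :
    dropRate n d η * callUnit n d η = Real.log (n + d) / 32768 := by
  have h1 : (1 : ℝ) ≤ n := by exact_mod_cast P.hn
  have h2 := P.hη
  rw [dropRate, callUnit]
  field_simp

lemma le_callUnit (P : IsLoadProblem n d η Γ β Ψ X f) : (n : ℝ) + d ≤ callUnit n d η := by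
  have h1 : (1 : ℝ) ≤ n := by exact_mod_cast P.hn
  have h2 := half_le_log P.hn P.hd
  have h3 := P.hη
  have h4 := P.hη5
  rw [callUnit, div_mul_eq_mul_div, le_div_iff₀ (by positivity)]
  have : η ^ 2 ≤ 1 / 2 := by nlinarith
  gcongr
  linarith

lemma two_le_callUnit (P : IsLoadProblem n d η Γ β Ψ X f) : 2 ≤ callUnit n d η := by
  have h1 : (1 : ℝ) ≤ n := by exact_mod_cast P.hn
  have h2 : (1 : ℝ) ≤ d := by exact_mod_cast P.hd
  linarith [P.le_callUnit]

lemma gradientBudget_le (P : IsLoadProblem n d η Γ β Ψ X f) :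
    (gradientBudget n d η : ℝ) ≤ 2 ^ 27 * callUnit n d η := by
  have h1 := P.two_le_callUnit
  have h2 := Nat.ceil_lt_add_one (a := 2 ^ 26 * callUnit n d η) (by linarith)
  rw [gradientBudget]
  push_cast
  linarith

lemma callBudget_le (P : IsLoadProblem n d η Γ β Ψ X f) :
    (callBudget n d η : ℝ) ≤ 2 ^ 30 * callUnit n d η + 1 :=
  (Nat.ceil_lt_add_one (by linarith [P.two_le_callUnit])).le

theorem guarantee_loadAlg (P : IsLoadProblem n d η Γ β Ψ X f) :
    (loadAlg n d η Γ).Guarantee (orthantGradient Ψ) f (IsCorrect η Γ β X)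
      (gradientBudget n d η) (callBudget n d η + n * gradientBudget n d η + n) := by
  have hn0 : n ≠ 0 := Nat.one_le_iff_ne_zero.mp P.hn
  rw [loadAlg, dif_neg hn0]
  refine OracleAlg.guarantee_askAll ?_
  split_ifs with h
  · exact OracleAlg.guarantee_halt (P.lt_optValue_of_initial h) _ _
  · have hinv := P.invariant_initial h
    have : NeZero n := ⟨hn0⟩
    refine P.isPotential.guarantee_search (dropRate_pos P.hn P.hη) _ _ _ hinv ?_
    refine (P.searchPotential_initial_le hinv).trans_lt ?_
    have h1 : 2 ^ 26 * callUnit n d η < gradientBudget n d η := by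
      rw [gradientBudget]
      push_cast
      linarith [Nat.le_ceil (2 ^ 26 * callUnit n d η)]
    have h2 := mul_lt_mul_of_pos_left h1 (dropRate_pos (d := d) P.hn P.hη)
    have h3 := P.dropRate_mul_callUnit
    nlinarith

theorem overrun_loadAlg_le (P : IsLoadProblem n d η Γ β Ψ X f) :
    (loadAlg n d η Γ).overrun (orthantGradient Ψ) f (callBudget n d η + n) ≤
      ENNReal.ofReal ((((n : ℝ) * d) ^ 20)⁻¹) := by
  have hn0 : n ≠ 0 := Nat.one_le_iff_ne_zero.mp P.hn
  have hn1 : (1 : ℝ) ≤ n := by exact_mod_cast P.hn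
  have hd1 : (1 : ℝ) ≤ d := by exact_mod_cast P.hd
  rw [loadAlg, dif_neg hn0, OracleAlg.overrun_askAll]
  split_ifs with h
  · rw [OracleAlg.overrun_halt]
    exact zero_le
  · have hinv := P.invariant_initial h
    have : NeZero n := ⟨hn0⟩
    refine (P.isPotential.overrun_search_le (dropRate_pos P.hn P.hη)
      (dropRate_le_one P.hn P.hη P.hη5) (dropRate_mul_le P.hn P.hη P.hη5) _ _ _ hinv).trans
      (ENNReal.ofReal_le_ofReal ?_)
    have hL := half_le_log P.hn P.hd
    have h1 := P.searchPotential_initial_le hinv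
    have h2 := dropRate_mul_le (d := d) P.hn P.hη P.hη5
    have h3 := mul_le_mul_of_nonneg_left (Nat.le_ceil (2 ^ 30 * callUnit n d η))
      (dropRate_pos (d := d) P.hn P.hη).le
    have h4 := P.dropRate_mul_callUnit
    have h5 : 32768 * Real.log (n + d) ≤ dropRate n d η * callBudget n d η := by
      unfold callBudget
      nlinarith
    calc SearchScheme.tail n (dropRate n d η) _ (callBudget n d η)
        ≤ Real.exp (-(40 * Real.log (n + d))) := by
          refine Real.exp_le_exp.mpr ?_
          linarith
      _ = (((n : ℝ) + d) ^ 40)⁻¹ := by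
          rw [Real.exp_neg, mul_comm, Real.exp_mul, Real.exp_log (by linarith)]
          norm_num
      _ ≤ (((n : ℝ) * d) ^ 20)⁻¹ := by
          refine inv_anti₀ (by positivity) ?_
          rw [show (40 : ℕ) = 2 * 20 by norm_num, pow_mul]
          gcongr
          nlinarith

end IsLoadProblem

theorem mainTheorem8 :
    ∃ (alg : ∀ n d : ℕ, ℝ → ℝ → OracleAlg n d) (Ω : ℕ → ℕ → ℝ → ℝ) (K : ℝ),
      (∀ (n d : ℕ) (η : ℝ), 1 ≤ n → 1 ≤ d → 0 < η → η ≤ 1 / 5 →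
        Ω n d η ≤ K * (((n : ℝ) + d) / η ^ 2 * Real.log ((n : ℝ) + d))) ∧
      ∀ (n d : ℕ) (η Γ : ℝ), 1 ≤ n → 1 ≤ d → 0 < η → η ≤ 1 / 5 → 0 < Γ →
        ∀ (β : Fin d → ℝ) (Ψ : (Fin d → ℝ) → ℝ),
          IsOrderedWeight β → IsNormApproximation (Real.log d / η) η β Ψ →
          ∀ (X : Fin n → Set (Fin d → ℝ)) (f : Fin n → (Fin d → ℝ) → (Fin d → ℝ)),
            IsLoadInstance X → IsLinMinOracle X f →
            (∀ r ∈ ((alg n d η Γ).run (orthantGradient Ψ) f).support,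
              (r.out = none → Γ < optValue β X) ∧
              (∀ s, r.out = some s →
                s ∈ feasibleSet X ∧ orderedNorm β s ≤ (1 + 3 * η) * Γ) ∧
              (r.gradientEvals : ℝ) ≤ 4 * Ω n d η ∧
              (r.oracleCalls : ℝ) ≤ (4 + (n : ℝ)) * Ω n d η) ∧
            ENNReal.ofReal (1 - 2 * (((n : ℝ) * d) ^ 20)⁻¹) ≤
              ((alg n d η Γ).run (orthantGradient Ψ) f).toOuterMeasure
                {r | (r.oracleCalls : ℝ) ≤ 4 * Ω n d η} := by
  refine ⟨loadAlg, fun n d η => 2 ^ 30 * callUnit n d η, 2 ^ 30, fun n d η _ _ _ _ => le_rfl, ?_⟩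
  intro n d η Γ hn hd hη hη5 hΓ β Ψ hβ hΨ X f hX hf
  have P : IsLoadProblem n d η Γ β Ψ X f := ⟨hn, hd, hη, hη5, hΓ, hβ, hΨ, hX, hf⟩
  have hU := P.two_le_callUnit
  have hnd := P.le_callUnit
  have hG := P.gradientBudget_le
  have hC := P.callBudget_le
  have hn0 : (0 : ℝ) ≤ n := n.cast_nonneg
  have hd0 : (0 : ℝ) ≤ d := d.cast_nonneg
  have hcalls : (callBudget n d η : ℝ) + n ≤ 4 * (2 ^ 30 * callUnit n d η) := by linarith
  refine ⟨fun r hr => ?_, ?_⟩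
  · obtain ⟨h1, h2, h3⟩ := P.guarantee_loadAlg r hr
    refine ⟨fun h => by rw [h] at h1; exact h1, fun s h => by rw [h] at h1; exact h1, ?_, ?_⟩
    · have : (r.gradientEvals : ℝ) ≤ gradientBudget n d η := by exact_mod_cast h2
      linarith
    · have h4 : (r.oracleCalls : ℝ) ≤ callBudget n d η + n * gradientBudget n d η + n := by
        exact_mod_cast h3
      have h5 : (n : ℝ) * gradientBudget n d η ≤ n * (2 ^ 30 * callUnit n d η) := by
        gcongr
        linarith
      linarith
  · set μ := ((loadAlg n d η Γ).run (orthantGradient Ψ) f).toOuterMeasure with hμ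
    have h1 : (1 : ENNReal) ≤ μ {r | (r.oracleCalls : ℝ) ≤ 4 * (2 ^ 30 * callUnit n d η)} +
        (loadAlg n d η Γ).overrun (orthantGradient Ψ) f (callBudget n d η + n) := by
      rw [← (PMF.toOuterMeasure_apply_eq_one_iff ((loadAlg n d η Γ).run (orthantGradient Ψ) f)
        (s := Set.univ)).mpr (Set.subset_univ _)]
      refine le_trans (MeasureTheory.measure_mono (fun r _ => ?_))
        (MeasureTheory.measure_union_le _ _)
      rcases le_or_gt r.oracleCalls (callBudget n d η + n) with h | h
      · left
        have : (r.oracleCalls : ℝ) ≤ callBudget n d η + n := by exact_mod_cast h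
        exact this.trans hcalls
      · exact Or.inr h
    have h2 := h1.trans (add_le_add_right P.overrun_loadAlg_le _)
    have h3 : 0 ≤ (((n : ℝ) * d) ^ 20)⁻¹ := by positivity
    calc ENNReal.ofReal (1 - 2 * (((n : ℝ) * d) ^ 20)⁻¹)
        ≤ ENNReal.ofReal (1 - (((n : ℝ) * d) ^ 20)⁻¹) := ENNReal.ofReal_le_ofReal (by linarith)
      _ = 1 - ENNReal.ofReal ((((n : ℝ) * d) ^ 20)⁻¹) := by
          rw [ENNReal.ofReal_sub _ h3, ENNReal.ofReal_one]
      _ ≤ _ := tsub_le_iff_right.mpr h2
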